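/- Let $F$ be a finite field of characteristic $p$ and order $q=p^n$, so $n=[F:\mathbb F_p]$, and let $d$ be a positive integer with $\gcd(d,q-1)=1$. Let $\psi\colon F\to\mathbb C$, $\psi(x)=e^{2\pi i\operatorname{Tr}(x)/p}$, be the canonical additive character of $F$, where $\operatorname{Tr}\colon F\to\mathbb F_p$ is the absolute trace. For $a\in F$ let $$W_{F,d}(a)=\sum_{x\in F}\psi(x^d-ax)\in\mathbb Q(e^{2\pi i/p}),\qquad V_{F,d}=\min_{a\in F}\operatorname{val}_p\bigl(W_{F,d}(a)\bigr),$$ where $\operatorname{val}_p$ is the extension of the $p$-adic valuation from $\mathbb Q$ to $\mathbb Q(e^{2\pi i/p})$, with $\operatorname{val}_p(1-e^{2\pi i/p})=1/(p-1)$ and $\operatorname{val}_p(0)=\infty$. For $K=F$ or $K=\mathbb F_p$, say that $d$ is *degenerate over $K$* if $d$ is congruent modulo $|K|-1$ to a power $p^k$ with $k\ge 0$, and *nondegenerate over $K$* otherwise. **Theorem 1.1.** (i) If $d$ is degenerate over $F$, then $V_{F,d}=[F:\mathbb F_p]$. (ii) If $d$ is nondegenerate over $F$ but degenerate over $\mathbb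 F_p$, then (a) if $[F:\mathbb F_p]$ is a power of $2$, then $V_{F,d}\le\frac12[F:\mathbb F_p]$; (b) otherwise, $V_{F,d}\le\frac23[F:\mathbb F_p]$. (iii) If $d$ is nondegenerate over $\mathbb F_p$, then $p\ge 5$, and (a) if $p\equiv1\pmod 4$ and $[F:\mathbb F_p]$ is odd, then $V_{F,d}\le\frac12[F:\mathbb F_p]$; (b) otherwise, $V_{F,d}\le\frac1{p-1}\left\lceil\frac{p-1}3\right\rceil[F:\mathbb F_p]$. -/

import Mathlib

namespace WeilSum

open NumberField

noncomputable section

/-- The complex number `e^{2πi/p}`. -/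
def zeta (p : ℕ) : ℂ := Complex.exp (2 * Real.pi * Complex.I / p)

theorem isPrimitiveRoot_zeta (p : ℕ) [Fact p.Prime] : IsPrimitiveRoot (zeta p) p :=
  Complex.isPrimitiveRoot_exp p (Fact.out : p.Prime).ne_zero

/-- The field `ℚ(e^{2πi/p})`, as a subfield of `ℂ`. -/
abbrev CycField (p : ℕ) : IntermediateField ℚ ℂ := IntermediateField.adjoin ℚ {zeta p}

instance instIsCyclotomicExtension (p : ℕ) [Fact p.Prime] :
    IsCyclotomicExtension {p} ℚ (CycField p) :=
  (IntermediateField.isCyclotomicExtension_singleton_iff_eq_adjoin p ℚ ℂ (CycField p)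
    (isPrimitiveRoot_zeta p)).2 rfl

instance instNumberField (p : ℕ) [Fact p.Prime] : NumberField (CycField p) :=
  IsCyclotomicExtension.numberField {p} ℚ (CycField p)

/-- `e^{2πi/p}` as an element of `ℚ(e^{2πi/p})`. -/
def zetaK (p : ℕ) : CycField p := IntermediateField.AdjoinSimple.gen ℚ (zeta p)

theorem coe_zetaK (p : ℕ) : (zetaK p : ℂ) = zeta p := rfl

theorem isPrimitiveRoot_zetaK (p : ℕ) [Fact p.Prime] : IsPrimitiveRoot (zetaK p) p :=
  IsPrimitiveRoot.of_map_of_injective (f := (CycField p).val) (isPrimitiveRoot_zeta p)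
    (CycField p).val.injective

/-- `e^{2πi/p}` as an algebraic integer of `ℚ(e^{2πi/p})`. -/
def zetaO (p : ℕ) [Fact p.Prime] : 𝓞 (CycField p) := (isPrimitiveRoot_zetaK p).toInteger

theorem prime_zetaO_sub_one (p : ℕ) [Fact p.Prime] : Prime (zetaO p - 1) :=
  (isPrimitiveRoot_zetaK p).zeta_sub_one_prime'

/-- The prime ideal of the ring of integers of `ℚ(e^{2πi/p})` generated by `e^{2πi/p} - 1`,
which is the only prime ideal above `p`. -/
def primeAbove (p : ℕ) [Fact p.Prime] :
    IsDedekindDomain.HeightOneSpectrum (𝓞 (CycField p)) where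
  asIdeal := Ideal.span {zetaO p - 1}
  isPrime := (Ideal.span_singleton_prime (prime_zetaO_sub_one p).ne_zero).2 (prime_zetaO_sub_one p)
  ne_bot := by
    rw [Ne, Ideal.span_singleton_eq_bot]
    exact (prime_zetaO_sub_one p).ne_zero

open Classical in
/-- The extension to `ℚ(e^{2πi/p})` of the `p`-adic valuation of `ℚ`, written additively: the
exponent of `primeAbove p`, divided by `p - 1`, so that `1 - e^{2πi/p}` has valuation
`1 / (p - 1)`. The valuation of `0` is `⊤`. -/
def val (p : ℕ) [Fact p.Prime] (x : CycField p) : WithTop ℚ :=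
  if x = 0 then ⊤
  else (((-(WithZero.log ((primeAbove p).valuation (CycField p) x)) : ℤ) : ℚ) / ((p : ℚ) - 1) : ℚ)

/-- The normalization of the valuation. -/
theorem val_one_sub_zetaK (p : ℕ) [Fact p.Prime] :
    val p (1 - zetaK p) = ((1 / ((p : ℚ) - 1) : ℚ) : WithTop ℚ) := by
  have h0 : zetaO p - 1 ≠ 0 := (prime_zetaO_sub_one p).ne_zero
  have hc : algebraMap (𝓞 (CycField p)) (CycField p) (zetaO p - 1) = zetaK p - 1 := by
    rw [map_sub, map_one]; rfl
  have h1 : zetaK p - 1 ≠ 0 := by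
    rw [← hc]; exact fun h => h0 (RingOfIntegers.coe_eq_zero_iff.1 h)
  have h2 : (1 : CycField p) - zetaK p ≠ 0 := by
    intro h; apply h1; rw [← neg_sub, h, neg_zero]
  rw [val, if_neg h2, ← neg_sub, Valuation.map_neg, ← hc,
    IsDedekindDomain.HeightOneSpectrum.valuation_of_algebraMap,
    (primeAbove p).intValuation_singleton h0 rfl]
  simp

section

variable (p : ℕ) [Fact p.Prime] (F : Type*) [Field F] [Algebra (ZMod p) F]

/-- The canonical additive character `x ↦ e^{2πi Tr(x)/p}` of a finite field `F` of characteristic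
`p`, where `Tr : F → 𝔽_p` is the absolute trace. -/
def psi (x : F) : ℂ :=
  Complex.exp (2 * Real.pi * Complex.I * ((Algebra.trace (ZMod p) F x).val : ℂ) / p)

theorem psi_eq_zeta_pow (x : F) : psi p F x = zeta p ^ (Algebra.trace (ZMod p) F x).val := by
  rw [psi, zeta, ← Complex.exp_nat_mul]
  congr 1
  ring

variable [Fintype F]

/-- The Weil sum `W_{F,d}(a) = ∑_{x ∈ F} ψ(x^d - a x)`. -/
def weilSum (d : ℕ) (a : F) : ℂ := ∑ x : F, psi p F (x ^ d - a * x)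

theorem weilSum_mem (d : ℕ) (a : F) : weilSum p F d a ∈ CycField p := by
  refine sum_mem fun x _ => ?_
  rw [psi_eq_zeta_pow]
  exact pow_mem (IntermediateField.mem_adjoin_simple_self ℚ (zeta p)) _

/-- `V_{F,d} = min_{a ∈ F} val_p (W_{F,d}(a))`. -/
def V (d : ℕ) : WithTop ℚ :=
  Finset.univ.inf' ⟨(0 : F), Finset.mem_univ _⟩ fun a : F =>
    val p ⟨weilSum p F d a, weilSum_mem p F d a⟩

end

/-- `d` is degenerate over the finite field `K` of characteristic `p`: it is congruent to a power
of `p` modulo `|K| - 1`. -/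
def Degenerate (p : ℕ) (K : Type*) (d : ℕ) : Prop := ∃ k : ℕ, d ≡ p ^ k [MOD Nat.card K - 1]

end

end WeilSum

/-!
The valuation is read off as a norm: `ℚ(e^{2πi/p})` embeds into an algebraic closure of `ℚ_p`, and
an upper bound for `V` is a lower bound for the norm of some Weil sum.

If `d` is degenerate, then `x^d` and `x` have the same trace, so that the Weil sum is `q` at `a = 1`
and `0` elsewhere (`V_eq_of_degenerate`).

The bound `2n/3` holds for every nondegenerate `d` (`V_le_two_thirds`). Otherwise each product of
three Weil sums would be divisible by a higher power of the prime above `p` than `q^2` is. The third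
moments of the Weil sums are the numbers `q^2 (N - 1)`, where `N` counts the common points of a line
`αX + βY + γZ = 0`, `αβγ ≠ 0`, with the set of the `q + 1` points `[x^d : y^d : z^d]`,
`x + y + z = 0`, of the projective plane; so no `N` could vanish. A set of `q + 1` points that meets
every line is a line (`additive_of_blocking`), so `x ↦ x^d` would be additive, hence a power of the
Frobenius automorphism.

If `n` is a power of `2` and `d` is degenerate over `𝔽_p`, then somewhere in the tower of quadratic
extensions from `𝔽_p` to `F` the exponent changes from degenerate over a field `K` to nondegenerate
over its quadratic extension `L`. The Weil sums over `L` are then `|K|` times integers that are at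
least `-1`, and if the value `-|K|` did not occur, the first two moments would force `x ↦ x^d` to be
additive (`exists_norm_charSum_ge_of_quadratic`). This is the bound `[L : 𝔽_p]/2` over `L`.

The remaining bounds, and the passage from `L` to `F`, rest on Stickelberger's theorem on the
valuations of Gauss sums (`pow_weight_le_norm_gaussSum`, `norm_gaussSum_le_pow_weight`). The Fourier
coefficients of the Weil sum in `a` are products of two Gauss sums. Thus a number `A`, not divisible
by `q - 1`, and a `B ≡ -dA` modulo `q - 1` give the upper bound `(s(A) + s(B)) / (p - 1)` for `V`,
where `s` is the sum of the digits to the base `p`; conversely, every Weil sum of small valuation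
comes from such a pair. Repeating the digits transports a bound from a subfield to `F`
(`V_le_of_digits`).

If `d` is nondegenerate over `𝔽_p`, one-digit numbers `j` and `k ≡ -dj` modulo `p - 1` are needed
with `j + k ≤ ⌈(p - 1)/3⌉`. Short vectors of this lattice provide them (`exists_add_le_third`) unless
`d ≡ 1 + (p - 1)/2` modulo `p - 1`. As `d` is odd, the exceptional class occurs only for `p ≡ 1`
modulo `4`; there `j = 1` gives the bound `n/2`, which suffices for odd `n` and for `p = 5`,
and pairs of two-digit numbers (`exists_digit_pair`) give `n/4` for even `n` and `p ≥ 13`.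
-/

namespace WeilSum

open Finset

/-! ### Power permutations of a finite field -/

section PowerMaps

variable {F : Type*} [Field F] {d : ℕ}

theorem pow_bijective_of_coprime [Fintype F] (hd : 0 < d)
    (hgcd : Nat.gcd d (Nat.card F - 1) = 1) : Function.Bijective fun x : F => x ^ d := by
  refine Finite.injective_iff_bijective.1 fun x y (hxy : x ^ d = y ^ d) => ?_
  rcases eq_or_ne x 0 with rfl | hx
  · rw [zero_pow hd.ne'] at hxy
    exact (eq_zero_of_pow_eq_zero hxy.symm).symm
  rcases eq_or_ne y 0 with rfl | hy
  · rw [zero_pow hd.ne'] at hxy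
    exact eq_zero_of_pow_eq_zero hxy
  have hc : (Nat.card Fˣ).Coprime d := by
    rw [Nat.card_units]; exact Nat.Coprime.symm hgcd
  have h : Units.mk0 x hx = Units.mk0 y hy :=
    hc.pow_left_bijective.1 (Units.ext (by simpa using hxy))
  simpa using congrArg Units.val h

theorem neg_pow_of_bijective (hb : Function.Bijective fun x : F => x ^ d) (x : F) :
    (-x) ^ d = -x ^ d := by
  have h : (-1 : F) ^ d = -1 := by
    have h2 : ((-1 : F) ^ d) ^ 2 = 1 := by rw [← pow_mul, mul_comm, pow_mul]; simp
    rcases eq_or_eq_neg_of_sq_eq_sq ((-1 : F) ^ d) 1 (by rw [h2, one_pow]) with h | h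
    · have : (-1 : F) = 1 := hb.1 (by simpa using h)
      rw [h, this]
    · exact h
  rw [neg_pow, h, neg_one_mul]

/-- A power map that is additive is a power of the Frobenius automorphism. -/
theorem degenerate_of_additive (p : ℕ) [Fact p.Prime] [Fintype F] [Algebra (ZMod p) F] (hd : 0 < d)
    (hadd : ∀ u v : F, (u + v) ^ d = u ^ d + v ^ d) : Degenerate p F d := by
  classical
  let f : F →+* F :=
    { toFun := fun x => x ^ d
      map_one' := one_pow d
      map_mul' := fun x y => mul_pow x y d
      map_zero' := zero_pow hd.ne'
      map_add' := hadd }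
  let g : F →ₐ[ZMod p] F :=
    { f with
      commutes' := fun r => RingHom.congr_fun
        (Subsingleton.elim (f.comp (algebraMap (ZMod p) F)) (algebraMap (ZMod p) F)) r }
  obtain ⟨k, hk⟩ := FiniteField.exists_forall_apply_eq_pow (ZMod p) p F
    (AlgEquiv.ofBijective g (Finite.injective_iff_bijective.1 g.toRingHom.injective))
  have hk' : ∀ x : F, x ^ d = x ^ p ^ k := by
    intro x
    have h := hk x
    rw [Nat.card_zmod] at h
    exact h
  refine ⟨k, ?_⟩
  obtain ⟨γ, hγ⟩ := IsCyclic.exists_generator (α := Fˣ)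
  have h := (pow_eq_pow_iff_modEq (x := γ) (n := d) (m := p ^ k)).1
    (Units.ext (by simpa using hk' γ))
  rwa [orderOf_eq_card_of_forall_mem_zpowers hγ, Nat.card_units] at h

/-- A projective form of the classification of the smallest blocking sets: if every line
`αX + βY + γZ = 0` with `αβγ ≠ 0` meets the set of the points `[x^d : y^d : z^d]` with
`x + y + z = 0`, then this set is the line `X + Y + Z = 0`, that is, `x ↦ x^d` is additive. -/
theorem additive_of_blocking [Finite F] (hd : 0 < d) (hb : Function.Bijective fun x : F => x ^ d)
    (H : ∀ α β γ : F, α ≠ 0 → β ≠ 0 → γ ≠ 0 → ∃ x y z : F, (x ≠ 0 ∨ y ≠ 0 ∨ z ≠ 0) ∧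
      x + y + z = 0 ∧ α * x ^ d + β * y ^ d + γ * z ^ d = 0) (u v : F) :
    (u + v) ^ d = u ^ d + v ^ d := by
  have hneg := neg_pow_of_bijective hb
  have hz : (0 : F) ^ d = 0 := zero_pow hd.ne'
  -- the lines with a vanishing coefficient meet the set because the power map is onto
  have H' : ∀ α β γ : F, ∃ x y z : F, (x ≠ 0 ∨ y ≠ 0 ∨ z ≠ 0) ∧
      x + y + z = 0 ∧ α * x ^ d + β * y ^ d + γ * z ^ d = 0 := by
    intro α β γ
    rcases eq_or_ne α 0 with rfl | hα
    · rcases eq_or_ne β 0 with rfl | hβ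
      · exact ⟨1, -1, 0, by simp, by simp, by simp [hz]⟩
      · obtain ⟨y, hy : y ^ d = -γ / β⟩ := hb.2 (-γ / β)
        exact ⟨-y - 1, y, 1, by simp, by ring, by rw [hy]; field_simp; simp⟩
    rcases eq_or_ne β 0 with rfl | hβ
    · obtain ⟨x, hx : x ^ d = -γ / α⟩ := hb.2 (-γ / α)
      exact ⟨x, -x - 1, 1, by simp, by ring, by rw [hx]; field_simp; simp⟩
    rcases eq_or_ne γ 0 with rfl | hγ
    · obtain ⟨x, hx : x ^ d = -β / α⟩ := hb.2 (-β / α)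
      exact ⟨x, 1, -x - 1, by simp, by ring, by rw [hx]; field_simp; simp⟩
    exact H α β γ hα hβ hγ
  rcases eq_or_ne u 0 with rfl | hu
  · simp [hz]
  rcases eq_or_ne v 0 with rfl | hv
  · simp [hz]
  by_contra hne
  obtain ⟨w, hw : w ^ d = u ^ d + v ^ d⟩ := hb.2 (u ^ d + v ^ d)
  have hwne : w ≠ u + v := fun h => hne (by rw [← h, hw])
  -- the lines through `[u^d : v^d : -(u^d + v^d)]` other than `X + Y + Z = 0` form a pencil with
  -- parameter `t`; sending a point of the set to the line of the pencil through it is a map `G`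
  let G : F → F := fun ξ =>
    -(v ^ d * ξ ^ d - u ^ d * (-1 - ξ) ^ d) / (ξ ^ d + (-1 - ξ) ^ d + 1)
  have hG : ∀ t : F, ∃ ξ, ξ ≠ 0 ∧ G ξ = t := by
    intro t
    obtain ⟨x, y, z, hxyz, hsum, hline⟩ := H' (v ^ d + t) (t - u ^ d) t
    have hL : x ^ d + y ^ d + z ^ d ≠ 0 := by
      intro h0
      have h1 : v ^ d * x ^ d = u ^ d * y ^ d := by linear_combination hline - t * h0
      obtain ⟨l, rfl⟩ : ∃ l, x = l * u := ⟨x / u, by field_simp⟩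
      have h2 : y = l * v := by
        apply hb.1
        have hud : u ^ d ≠ 0 := pow_ne_zero _ hu
        apply mul_left_cancel₀ hud
        change u ^ d * y ^ d = u ^ d * (l * v) ^ d
        rw [← h1]; ring
      subst h2
      have h3 : z = -(l * w) := by
        apply hb.1
        change z ^ d = (-(l * w)) ^ d
        rw [hneg, mul_pow, hw]
        linear_combination h0 - mul_pow l u d - mul_pow l v d
      subst h3
      have h4 : l * (u + v - w) = 0 := by linear_combination hsum
      rcases mul_eq_zero.1 h4 with rfl | h5
      · simp at hxyz
      · exact hwne (sub_eq_zero.1 h5).symm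
    have hz0 : z ≠ 0 := by
      rintro rfl
      have : y = -x := by linear_combination hsum
      apply hL; rw [this, hneg, hz]; ring
    have hx0 : x ≠ 0 := by
      rintro rfl
      have : y = -z := by linear_combination hsum
      apply hL; rw [this, hneg, hz]; ring
    refine ⟨x / z, div_ne_zero hx0 hz0, ?_⟩
    have hy : -1 - x / z = y / z := by field_simp; linear_combination -hsum
    have hzd : z ^ d ≠ 0 := pow_ne_zero _ hz0
    have hL' : (x / z) ^ d + (y / z) ^ d + 1 ≠ 0 := by
      intro h
      apply hL
      rw [div_pow, div_pow] at h
      field_simp at h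
      simpa using h
    change -(v ^ d * (x / z) ^ d - u ^ d * (-1 - x / z) ^ d) /
      ((x / z) ^ d + (-1 - x / z) ^ d + 1) = t
    rw [hy, div_eq_iff hL', div_pow, div_pow]
    field_simp
    linear_combination -hline
  have hsurj : Function.Surjective G := fun t => (hG t).imp fun _ h => h.2
  obtain ⟨ξ, hξ, hξ0⟩ := hG (G 0)
  exact hξ ((Finite.injective_iff_surjective.2 hsurj) hξ0)

end PowerMaps

/-! ### Power moments of Weil sums -/

section Moments

variable {F : Type*} [Field F] [Fintype F] {Ω : Type*} [Field Ω] {d : ℕ} {ψ : AddChar F Ω}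

/-- The Weil sum `∑ x, ψ (b x^d - a x)` for an additive character `ψ` of a finite field with values
in an arbitrary field, with a coefficient `b` at the monomial `x^d`. -/
def charSum (ψ : AddChar F Ω) (d : ℕ) (b a : F) : Ω := ∑ x : F, ψ (b * x ^ d - a * x)

theorem sum_char_mul (hψ : ψ.IsPrimitive) [DecidableEq F] (b : F) :
    ∑ x : F, ψ (x * b) = if b = 0 then (Fintype.card F : Ω) else 0 := by
  rw [AddChar.sum_mulShift b hψ]; split_ifs <;> simp

theorem charSum_pow_mul (c b a : F) : charSum ψ d (c ^ d * b) (c * a) =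
    ∑ x : F, ψ (b * (c * x) ^ d - a * (c * x)) := by
  refine Finset.sum_congr rfl fun x _ => ?_
  congr 1; ring

theorem charSum_pow (c : F) (hc : c ≠ 0) (a : F) :
    charSum ψ d (c ^ d) (c * a) = charSum ψ d 1 a := by
  have h := charSum_pow_mul (ψ := ψ) (d := d) c 1 a
  rw [mul_one] at h
  rw [h]
  exact Equiv.sum_comp (Equiv.mulLeft₀ c hc) fun x => ψ (1 * x ^ d - a * x)

theorem sum_charSum (hψ : ψ.IsPrimitive) (hd : 0 < d) :
    ∑ a : F, charSum ψ d 1 a = Fintype.card F := by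
  classical
  unfold charSum
  rw [Finset.sum_comm]
  have h : ∀ x : F, ∑ a : F, ψ (1 * x ^ d - a * x) =
      if x = 0 then (Fintype.card F : Ω) else 0 := by
    intro x
    have h1 : ∀ a : F, ψ (1 * x ^ d - a * x) = ψ (x ^ d) * ψ (a * -x) := by
      intro a; rw [← AddChar.map_add_eq_mul]; congr 1; ring
    simp_rw [h1, ← Finset.mul_sum, sum_char_mul hψ, neg_eq_zero]
    split_ifs with hx
    · rw [hx, zero_pow hd.ne']; simp
    · simp
  simp_rw [h]
  simp

theorem sum_charSum_sq (hψ : ψ.IsPrimitive) (hb : Function.Bijective fun x : F => x ^ d) :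
    ∑ a : F, charSum ψ d 1 a ^ 2 = (Fintype.card F : Ω) ^ 2 := by
  classical
  have h1 : ∀ a : F, charSum ψ d 1 a ^ 2 =
      ∑ x : F, ∑ y : F, ψ (x ^ d + y ^ d) * ψ (a * -(x + y)) := by
    intro a
    rw [sq, charSum, Finset.sum_mul_sum]
    refine Finset.sum_congr rfl fun x _ => Finset.sum_congr rfl fun y _ => ?_
    rw [← AddChar.map_add_eq_mul, ← AddChar.map_add_eq_mul]; congr 1; ring
  simp_rw [h1]
  rw [Finset.sum_comm]
  have h2 : ∀ x : F, ∑ a : F, ∑ y : F, ψ (x ^ d + y ^ d) * ψ (a * -(x + y)) = Fintype.card F := by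
    intro x
    rw [Finset.sum_comm]
    simp_rw [← Finset.mul_sum, sum_char_mul hψ, neg_eq_zero, add_eq_zero_iff_neg_eq, mul_ite,
      mul_zero]
    rw [Finset.sum_ite_eq Finset.univ (-x)]
    rw [neg_pow_of_bijective hb]
    simp
  simp_rw [h2]
  simp [sq]

/-- The third moment counts the points of `αX^d + βY^d + γZ^d = 0` on the plane `X + Y + Z = 0`,
which is parametrized here by `(X, Y)`. -/
theorem sum_charSum_mul_mul [DecidableEq F] (hψ : ψ.IsPrimitive)
    (hb : Function.Bijective fun x : F => x ^ d) (hd : 0 < d) (α β γ : F) :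
    ((Fintype.card F : Ω) - 1) *
      ∑ a : F, charSum ψ d α a * charSum ψ d β a * charSum ψ d γ a =
    (Fintype.card F : Ω) ^ 2 * ((#{v : F × F |
      α * v.1 ^ d + β * v.2 ^ d + γ * (-v.1 - v.2) ^ d = 0} : Ω) - Fintype.card F) := by
  set q : Ω := ((Fintype.card F : ℕ) : Ω) with hq
  let h : F × F → F := fun v => α * v.1 ^ d + β * v.2 ^ d + γ * (-v.1 - v.2) ^ d
  have hS : ∑ a : F, charSum ψ d α a * charSum ψ d β a * charSum ψ d γ a =
      q * ∑ v : F × F, ψ (h v) := by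
    have h1 : ∀ a : F, charSum ψ d α a * charSum ψ d β a * charSum ψ d γ a =
        ∑ v : F × F, ∑ z : F,
          ψ (α * v.1 ^ d + β * v.2 ^ d + γ * z ^ d) * ψ (a * -(v.1 + v.2 + z)) := by
      intro a
      simp only [charSum]
      rw [Finset.sum_mul_sum, ← Finset.univ_product_univ, Finset.sum_product, Finset.sum_mul]
      refine Finset.sum_congr rfl fun x _ => ?_
      rw [Finset.sum_mul_sum]
      refine Finset.sum_congr rfl fun y _ => Finset.sum_congr rfl fun z _ => ?_
      simp_rw [← AddChar.map_add_eq_mul]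
      congr 1; ring
    simp_rw [h1]
    rw [Finset.sum_comm, Finset.mul_sum]
    refine Finset.sum_congr rfl fun v _ => ?_
    rw [Finset.sum_comm]
    have h2 : ∀ z : F, -(v.1 + v.2 + z) = 0 ↔ -v.1 - v.2 = z := by
      intro z
      constructor <;> intro h <;> linear_combination h
    simp_rw [← Finset.mul_sum, sum_char_mul hψ, h2, mul_ite, mul_zero]
    rw [Finset.sum_ite_eq Finset.univ (-v.1 - v.2)]
    simp [h, hq, mul_comm]
  -- the plane is stable under scaling, so that `ψ ∘ h` may be averaged over the multiples of `h`
  have hscale : ∀ c : F, c ≠ 0 → ∑ v : F × F, ψ (c * h v) = ∑ v : F × F, ψ (h v) := by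
    intro c hc
    obtain ⟨e, he : e ^ d = c⟩ := hb.2 c
    have he0 : e ≠ 0 := by
      rintro rfl
      exact hc (by rw [← he, zero_pow hd.ne'])
    refine Eq.trans ?_ (Equiv.sum_comp ((Equiv.mulLeft₀ e he0).prodCongr (Equiv.mulLeft₀ e he0))
      fun v => ψ (h v))
    refine Finset.sum_congr rfl fun v _ => ?_
    congr 1
    simp only [h, Equiv.prodCongr_apply, Prod.map, Equiv.mulLeft₀_apply]
    rw [← he]
    rw [show -(e * v.1) - e * v.2 = e * (-v.1 - v.2) by ring, mul_pow, mul_pow, mul_pow]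
    ring
  have hsum : ∑ c : F, ∑ v : F × F, ψ (c * h v) = q * (#{v : F × F | h v = 0} : Ω) := by
    rw [Finset.sum_comm]
    simp_rw [sum_char_mul hψ]
    rw [Finset.sum_ite]
    simp [hq, mul_comm]
  have hsplit : ∑ c : F, ∑ v : F × F, ψ (c * h v) = q ^ 2 + (q - 1) * ∑ v : F × F, ψ (h v) := by
    rw [← Finset.add_sum_erase Finset.univ _ (Finset.mem_univ (0 : F)),
      Finset.sum_congr rfl fun c hc => hscale c (Finset.ne_of_mem_erase hc)]
    rw [Finset.sum_const, Finset.card_erase_of_mem (Finset.mem_univ _), Finset.card_univ,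
      nsmul_eq_mul, Nat.cast_sub Fintype.card_pos]
    simp [hq, sq]
  rw [hS]
  linear_combination q * (hsum - hsplit)

end Moments

section

variable {F : Type*} [Field F] [Fintype F] {Ω : Type*} [NormedField Ω] [IsUltrametricDist Ω]
  {d : ℕ} {ψ : AddChar F Ω}

/-- If the norms of all Weil sums are too small, then the third moments show that every line
`αX + βY + γZ = 0` with `αβγ ≠ 0` meets the set of the points `[x^d : y^d : z^d]` with
`x + y + z = 0`, so that `x ↦ x^d` is additive. -/
theorem additive_of_norm_charSum_lt (hψ : ψ.IsPrimitive) (hd : 0 < d)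
    (hb : Function.Bijective fun x : F => x ^ d) (hq0 : (Fintype.card F : Ω) ≠ 0)
    (hq : ‖(Fintype.card F : Ω)‖ < 1)
    (H : ∀ a : F, ‖charSum ψ d 1 a‖ ^ 3 < ‖(Fintype.card F : Ω)‖ ^ 2) (u v : F) :
    (u + v) ^ d = u ^ d + v ^ d := by
  classical
  refine additive_of_blocking hd hb (fun α β γ hα hβ hγ => ?_) u v
  have hW : ∀ b : F, b ≠ 0 → ∀ a, ‖charSum ψ d b a‖ ^ 3 < ‖(Fintype.card F : Ω)‖ ^ 2 := by
    intro b hb0 a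
    obtain ⟨c, hc : c ^ d = b⟩ := hb.2 b
    have hc0 : c ≠ 0 := by
      rintro rfl
      exact hb0 (by rw [← hc, zero_pow hd.ne'])
    have := H (a / c)
    rwa [← charSum_pow c hc0, hc, mul_div_cancel₀ a hc0] at this
  by_contra! hno
  have hcount : #{v : F × F | α * v.1 ^ d + β * v.2 ^ d + γ * (-v.1 - v.2) ^ d = 0} = 1 := by
    rw [Finset.card_eq_one]
    refine ⟨(0, 0), ?_⟩
    ext ⟨x, y⟩
    simp only [mem_filter, mem_univ, true_and, mem_singleton, Prod.mk.injEq]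
    constructor
    · intro h
      by_contra hxy
      refine hno x y (-x - y) ?_ (by ring) h
      by_cases hx : x = 0
      · exact Or.inr (Or.inl fun hy => hxy ⟨hx, hy⟩)
      · exact Or.inl hx
    · rintro ⟨rfl, rfl⟩
      simp [zero_pow hd.ne']
  have hmom := sum_charSum_mul_mul hψ hb hd α β γ
  rw [hcount] at hmom
  obtain ⟨a, -, ha⟩ := IsUltrametricDist.exists_norm_finsetSum_le_of_nonempty
    (Finset.univ_nonempty (α := F))
    (fun a => charSum ψ d α a * charSum ψ d β a * charSum ψ d γ a)
  set q : Ω := ((Fintype.card F : ℕ) : Ω) with hqdef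
  have hq1 : ‖q - 1‖ = 1 := by
    rw [norm_sub_rev]
    have := IsUltrametricDist.norm_add_eq_max_of_norm_ne_norm (x := (1 : Ω)) (y := -q)
      (by rw [norm_one, norm_neg]; exact hq.ne')
    rw [sub_eq_add_neg, this, norm_neg, norm_one, max_eq_left hq.le]
  have hq2 : ‖((1 : ℕ) : Ω) - q‖ = 1 := by rw [Nat.cast_one, norm_sub_rev, hq1]
  have hn := congrArg norm hmom
  rw [norm_mul, norm_mul, hq1, hq2, one_mul, mul_one, norm_pow] at hn
  rw [hn, norm_mul, norm_mul] at ha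
  -- compare cubes
  have h3 : (‖q‖ ^ 2) ^ 3 < (‖q‖ ^ 2) ^ 3 := calc
    (‖q‖ ^ 2) ^ 3 ≤ (‖charSum ψ d α a‖ * ‖charSum ψ d β a‖ * ‖charSum ψ d γ a‖) ^ 3 :=
      pow_le_pow_left₀ (by positivity) ha 3
    _ = ‖charSum ψ d α a‖ ^ 3 * ‖charSum ψ d β a‖ ^ 3 * ‖charSum ψ d γ a‖ ^ 3 := by ring
    _ < ‖q‖ ^ 2 * ‖q‖ ^ 2 * ‖q‖ ^ 2 := by
      have hpos : 0 < ‖q‖ ^ 2 := by positivity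
      exact mul_lt_mul'' (mul_lt_mul'' (hW α hα a) (hW β hβ a) (by positivity) (by positivity))
        (hW γ hγ a) (by positivity) (by positivity)
    _ = _ := by ring
  exact lt_irrefl _ h3

end

/-! ### The valuation as a `p`-adic norm -/

section Norm

open NumberField IsDedekindDomain

variable (p : ℕ) [Fact p.Prime]

/-- An embedding of `ℚ(e^{2πi/p})` into an algebraic closure of `ℚ_p`. -/
noncomputable def emb : CycField p →+* PadicAlgCl p :=
  (IsAlgClosed.lift : CycField p →ₐ[ℚ] PadicAlgCl p).toRingHom

/-- The norm of `e^{2πi/p} - 1` in an algebraic closure of `ℚ_p`. -/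
noncomputable def piNorm : ℝ := ‖emb p (zetaK p - 1)‖

theorem coe_zetaO_sub_one :
    algebraMap (𝓞 (CycField p)) (CycField p) (zetaO p - 1) = zetaK p - 1 := by
  rw [map_sub, map_one]; rfl

/-- The restriction of `emb p` to the ring of integers. -/
noncomputable def embO : 𝓞 (CycField p) →+* PadicAlgCl p :=
  (emb p).comp (algebraMap (𝓞 (CycField p)) (CycField p))

theorem norm_embO_zetaO_sub_one : ‖embO p (zetaO p - 1)‖ = piNorm p := by
  rw [embO, RingHom.comp_apply, coe_zetaO_sub_one, piNorm]

theorem norm_embO_le_one (x : 𝓞 (CycField p)) : ‖embO p x‖ ≤ 1 := by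
  have hx : IsIntegral ℤ (embO p x) :=
    (RingOfIntegers.isIntegral x).map (embO p).toIntAlgHom
  let v := (PadicAlgCl.valued p).v
  have hx' : IsIntegral v.integer (embO p x) := hx.tower_top
  have h : embO p x ∈ v.integer :=
    Valuation.Integers.mem_of_integral (Valuation.integer.integers v) hx'
  have h1 : v (embO p x) ≤ 1 := h
  exact_mod_cast h1

theorem norm_embO_of_isUnit {x : 𝓞 (CycField p)} (hx : IsUnit x) :
    ‖embO p x‖ = 1 := by
  obtain ⟨u, rfl⟩ := hx
  refine le_antisymm (norm_embO_le_one p _) ?_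
  have h : ‖embO p u‖ * ‖embO p (u⁻¹ : (𝓞 (CycField p))ˣ)‖ = 1 := by
    rw [← norm_mul, ← map_mul, Units.mul_inv]; simp
  rw [← h]
  exact mul_le_of_le_one_right (norm_nonneg _) (norm_embO_le_one p _)

theorem piNorm_pow : piNorm p ^ (p - 1) = ‖(p : PadicAlgCl p)‖ := by
  obtain ⟨u, hu⟩ := IsCyclotomicExtension.Rat.associated_zeta_sub_one_pow_prime p
    (isPrimitiveRoot_zetaK p)
  have h := congrArg (fun x : 𝓞 (CycField p) => ‖embO p x‖) hu
  simp only [map_mul, norm_mul, map_pow, norm_pow] at h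
  rw [norm_embO_of_isUnit p u.isUnit, mul_one] at h
  rw [← norm_embO_zetaO_sub_one]
  exact h.trans (by simp)

theorem norm_p_lt_one : ‖(p : PadicAlgCl p)‖ < 1 := by
  have h : ‖(p : PadicAlgCl p)‖ = ‖(p : ℚ_[p])‖ := by
    rw [← PadicAlgCl.norm_extends, map_natCast]
  rw [h]
  exact Padic.norm_p_lt_one

theorem piNorm_pos : 0 < piNorm p := by
  have h : zetaK p - 1 ≠ 0 := by
    rw [← coe_zetaO_sub_one]
    exact fun h => (prime_zetaO_sub_one p).ne_zero (RingOfIntegers.coe_eq_zero_iff.1 h)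
  rw [piNorm, norm_pos_iff]
  exact (map_ne_zero (emb p)).2 h

theorem piNorm_lt_one : piNorm p < 1 := by
  by_contra! h
  have := one_le_pow₀ h (n := p - 1)
  rw [piNorm_pow] at this
  exact this.not_gt (norm_p_lt_one p)

/-- An algebraic integer outside `primeAbove p` has norm `1`. -/
theorem norm_embO_of_not_dvd {x : 𝓞 (CycField p)} (hx : ¬ zetaO p - 1 ∣ x) :
    ‖embO p x‖ = 1 := by
  have hmax : (primeAbove p).asIdeal.IsMaximal :=
    (primeAbove p).isPrime.isMaximal (primeAbove p).ne_bot
  have hx' : x ∉ (primeAbove p).asIdeal := fun h => hx (Ideal.mem_span_singleton.1 h)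
  obtain ⟨y, i, hi, hyi⟩ := hmax.exists_inv hx'
  obtain ⟨z, rfl⟩ := Ideal.mem_span_singleton.1 hi
  refine le_antisymm (norm_embO_le_one p _) ?_
  have h1 : embO p y * embO p x +
      embO p (zetaO p - 1) * embO p z = 1 := by
    rw [← map_mul, ← map_mul, ← map_add, hyi, map_one]
  by_contra! hlt
  have h2 : ‖embO p y * embO p x +
      embO p (zetaO p - 1) * embO p z‖ < 1 := by
    refine (IsUltrametricDist.norm_add_le_max _ _).trans_lt (max_lt ?_ ?_)
    · rw [norm_mul]
      exact mul_lt_one_of_nonneg_of_lt_one_right (norm_embO_le_one p y) (norm_nonneg _) hlt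
    · rw [norm_mul]
      exact mul_lt_one_of_nonneg_of_lt_one_left (norm_nonneg _)
        ((norm_embO_zetaO_sub_one p).trans_lt (piNorm_lt_one p)) (norm_embO_le_one p z)
  rw [h1, norm_one] at h2
  exact lt_irrefl _ h2

theorem exists_valuation_eq_and_norm_eq {x : 𝓞 (CycField p)} (hx : x ≠ 0) :
    ∃ k : ℕ, (primeAbove p).valuation (CycField p) (algebraMap _ _ x) =
      WithZero.exp (-(k : ℤ)) ∧
      ‖embO p x‖ = piNorm p ^ k := by
  obtain ⟨y, hxy, hy⟩ :=
    (FiniteMultiplicity.of_prime_left (prime_zetaO_sub_one p) hx).exists_eq_pow_mul_and_not_dvd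
  refine ⟨multiplicity (zetaO p - 1) x, ?_, ?_⟩
  · have h1 : (primeAbove p).valuation (CycField p) (algebraMap _ _ y) = 1 :=
      (HeightOneSpectrum.valuation_eq_one_iff_notMem _).2
        fun h => hy (Ideal.mem_span_singleton.1 h)
    conv_lhs => rw [hxy]
    rw [map_mul, map_mul, h1, map_pow, map_pow, HeightOneSpectrum.valuation_of_algebraMap,
      (primeAbove p).intValuation_singleton (prime_zetaO_sub_one p).ne_zero rfl, mul_one,
      ← WithZero.exp_nsmul]
    simp
  · conv_lhs => rw [hxy]
    rw [map_mul, norm_mul, norm_embO_of_not_dvd p hy, mul_one, map_pow, norm_pow,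
      norm_embO_zetaO_sub_one]

theorem exists_val_eq_and_norm_eq {x : CycField p} (hx : x ≠ 0) :
    ∃ k : ℤ, val p x = (((k : ℚ) / ((p : ℚ) - 1) : ℚ) : WithTop ℚ) ∧
      ‖emb p x‖ = piNorm p ^ k := by
  obtain ⟨a, b, hb, rfl⟩ := IsFractionRing.div_surjective (A := 𝓞 (CycField p)) x
  have hb0 : b ≠ 0 := nonZeroDivisors.ne_zero hb
  have ha0 : a ≠ 0 := by rintro rfl; simp at hx
  obtain ⟨k, hk1, hk2⟩ := exists_valuation_eq_and_norm_eq p ha0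
  obtain ⟨l, hl1, hl2⟩ := exists_valuation_eq_and_norm_eq p hb0
  refine ⟨k - l, ?_, ?_⟩
  · rw [val, if_neg hx, map_div₀, hk1, hl1, ← WithZero.exp_sub, WithZero.log_exp]
    congr 3
    ring
  · change ‖embO p a‖ = _ at hk2
    change ‖embO p b‖ = _ at hl2
    rw [map_div₀, norm_div]
    change ‖embO p a‖ / ‖embO p b‖ = _
    rw [hk2, hl2, zpow_sub₀ (piNorm_pos p).ne']
    simp

theorem val_le_of_norm_le {x : CycField p} (D E : ℕ) (hD : 0 < D)
    (h : piNorm p ^ E ≤ ‖emb p x‖ ^ D) :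
    val p x ≤ (((E : ℚ) / (D * ((p : ℚ) - 1)) : ℚ) : WithTop ℚ) := by
  have hp1 : (0 : ℚ) < (p : ℚ) - 1 := by
    have : (1 : ℚ) < p := by exact_mod_cast (Fact.out : p.Prime).one_lt
    linarith
  have hx : x ≠ 0 := by
    rintro rfl
    rw [map_zero, norm_zero, zero_pow hD.ne'] at h
    exact (pow_pos (piNorm_pos p) E).not_ge h
  obtain ⟨k, hk1, hk2⟩ := exists_val_eq_and_norm_eq p hx
  rw [hk1, WithTop.coe_le_coe]
  rw [hk2, ← zpow_natCast, ← zpow_natCast, ← zpow_mul] at h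
  have h1 : k * D ≤ E := (zpow_le_zpow_iff_right_of_lt_one₀ (piNorm_pos p) (piNorm_lt_one p)).1 h
  have h2 : (k : ℚ) * D ≤ E := by exact_mod_cast h1
  have hD' : (0 : ℚ) < D := by exact_mod_cast hD
  rw [div_le_div_iff₀ hp1 (by positivity)]
  nlinarith

theorem val_eq_of_norm_eq {x : CycField p} {E : ℕ} (h : ‖emb p x‖ = piNorm p ^ E) :
    val p x = (((E : ℚ) / ((p : ℚ) - 1) : ℚ) : WithTop ℚ) := by
  have hx : x ≠ 0 := by
    rintro rfl
    rw [map_zero, norm_zero] at h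
    exact (pow_pos (piNorm_pos p) E).ne h
  obtain ⟨k, hk1, hk2⟩ := exists_val_eq_and_norm_eq p hx
  rw [hk2, ← zpow_natCast] at h
  have h1 : k = E := zpow_right_injective₀ (piNorm_pos p) (piNorm_lt_one p).ne h
  rw [hk1, h1]; simp

end Norm

/-! ### Digit vectors -/

section Digits

/-- The number `∑_{i<n} a_i b^i`, where the `a_i` are arbitrary natural numbers. -/
def digitVal (b n : ℕ) (a : ℕ → ℕ) : ℕ := ∑ i ∈ range n, a i * b ^ i

/-- The sum of the first `n` entries of `a`. -/
def weight (n : ℕ) (a : ℕ → ℕ) : ℕ := ∑ i ∈ range n, a i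

theorem digitVal_succ (b n : ℕ) (a : ℕ → ℕ) :
    digitVal b (n + 1) a = digitVal b n a + a n * b ^ n :=
  Finset.sum_range_succ _ _

theorem weight_succ (n : ℕ) (a : ℕ → ℕ) : weight (n + 1) a = weight n a + a n :=
  Finset.sum_range_succ _ _

theorem digitVal_digit (b n m : ℕ) : digitVal b n (fun i => m / b ^ i % b) = m % b ^ n := by
  induction n with
  | zero => simp [digitVal, Nat.mod_one]
  | succ n ih => rw [digitVal_succ, ih, Nat.mod_pow_succ]; ring

theorem exists_digits {b n m : ℕ} (hb : 0 < b) (hm : m < b ^ n) :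
    ∃ a : ℕ → ℕ, (∀ i, a i ≤ b - 1) ∧ digitVal b n a = m :=
  ⟨fun i => m / b ^ i % b, fun i => Nat.le_sub_one_of_lt (Nat.mod_lt _ hb),
    by rw [digitVal_digit, Nat.mod_eq_of_lt hm]⟩

theorem digitVal_add_digitVal_compl {b : ℕ} (hb : 0 < b) (n : ℕ) {a : ℕ → ℕ}
    (ha : ∀ i, a i ≤ b - 1) :
    digitVal b n a + digitVal b n (fun i => b - 1 - a i) = b ^ n - 1 := by
  have h : digitVal b n a + digitVal b n (fun i => b - 1 - a i) + 1 = b ^ n := by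
    induction n with
    | zero => simp [digitVal]
    | succ n ih =>
      rw [digitVal_succ, digitVal_succ]
      have h1 : a n + (b - 1 - a n) + 1 = b := by have := ha n; omega
      calc _ = (digitVal b n a + digitVal b n (fun i => b - 1 - a i) + 1) +
              (a n + (b - 1 - a n)) * b ^ n := by ring
        _ = (a n + (b - 1 - a n) + 1) * b ^ n := by rw [ih]; ring
        _ = b ^ (n + 1) := by rw [h1]; ring
  omega

theorem weight_add_weight_compl {b : ℕ} (n : ℕ) {a : ℕ → ℕ} (ha : ∀ i, a i ≤ b - 1) :
    weight n a + weight n (fun i => b - 1 - a i) = n * (b - 1) := by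
  rw [weight, weight, ← Finset.sum_add_distrib,
    Finset.sum_congr rfl fun i _ => Nat.add_sub_of_le (ha i)]
  simp

theorem digitVal_le {b : ℕ} (hb : 0 < b) (n : ℕ) (a : ℕ → ℕ) :
    digitVal b n a ≤ weight n a * b ^ (n - 1) := by
  rw [digitVal, weight, Finset.sum_mul]
  refine Finset.sum_le_sum fun i hi => Nat.mul_le_mul_left _ (Nat.pow_le_pow_right hb ?_)
  have := Finset.mem_range.1 hi
  omega

theorem digitVal_periodic (b m : ℕ) (a : ℕ → ℕ) (t : ℕ) :
    digitVal b (m * t) (fun i => a (i % m)) = digitVal b m a * ∑ l ∈ range t, (b ^ m) ^ l := by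
  induction t with
  | zero => simp [digitVal]
  | succ t ih =>
    rw [digitVal, Nat.mul_succ, Finset.sum_range_add, Finset.sum_range_succ, mul_add, ← ih, digitVal]
    congr 1
    rw [digitVal, Finset.sum_mul]
    refine Finset.sum_congr rfl fun i hi => ?_
    rw [Nat.mul_add_mod, Nat.mod_eq_of_lt (Finset.mem_range.1 hi), pow_add, pow_mul]
    ring

theorem weight_periodic (m : ℕ) (a : ℕ → ℕ) (t : ℕ) :
    weight (m * t) (fun i => a (i % m)) = t * weight m a := by
  induction t with
  | zero => simp [weight]
  | succ t ih =>
    rw [weight, Nat.mul_succ, Finset.sum_range_add, ← weight, ih, Nat.succ_mul]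
    congr 1
    refine Finset.sum_congr rfl fun i hi => ?_
    rw [Nat.mul_add_mod, Nat.mod_eq_of_lt (Finset.mem_range.1 hi)]

end Digits

/-! ### Norms of Gauss sums -/

section GaussSums

variable {F : Type*} [Field F] [Fintype F] {Ω : Type*} [NormedField Ω] {ψ : AddChar F Ω}

theorem norm_addChar (ψ : AddChar F Ω) (x : F) : ‖ψ x‖ = 1 := by
  refine (pow_eq_one_iff_of_nonneg (norm_nonneg _) Fintype.card_ne_zero (n := Fintype.card F)).1 ?_
  rw [← norm_pow, ← AddChar.map_nsmul_eq_pow, card_nsmul_eq_zero, AddChar.map_zero_eq_one, norm_one]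

theorem norm_mulChar (χ : MulChar F Ω) {x : F} (hx : x ≠ 0) : ‖χ x‖ = 1 := by
  refine (pow_eq_one_iff_of_nonneg (norm_nonneg _)
    (Nat.sub_ne_zero_of_lt (Fintype.one_lt_card (α := F)))).1 ?_
  rw [← norm_pow, ← map_pow, FiniteField.pow_card_sub_one_eq_one x hx, map_one, norm_one]

theorem norm_mulChar_le (χ : MulChar F Ω) (x : F) : ‖χ x‖ ≤ 1 := by
  rcases eq_or_ne x 0 with rfl | hx
  · rw [MulChar.map_zero, norm_zero]; exact zero_le_one
  · exact (norm_mulChar χ hx).le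

theorem gaussSum_pow_char (p : ℕ) [Fact p.Prime] [CharP F p] (hfrob : ∀ x, ψ (x ^ p) = ψ x)
    (χ : MulChar F Ω) : gaussSum (χ ^ p) ψ = gaussSum χ ψ := by
  rw [gaussSum, gaussSum, ← Equiv.sum_comp (frobeniusEquiv F p).toEquiv fun x => χ x * ψ x]
  refine Finset.sum_congr rfl fun x _ => ?_
  rw [MulChar.pow_apply' _ (Fact.out : p.Prime).ne_zero]
  change χ x ^ p * ψ x = χ (x ^ p) * ψ (x ^ p)
  rw [hfrob, map_pow]

theorem gaussSum_pow_char_pow (p : ℕ) [Fact p.Prime] [CharP F p] (hfrob : ∀ x, ψ (x ^ p) = ψ x)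
    (χ : MulChar F Ω) (i : ℕ) : gaussSum (χ ^ p ^ i) ψ = gaussSum χ ψ := by
  induction i with
  | zero => simp
  | succ i ih => rw [pow_succ, pow_mul, gaussSum_pow_char p hfrob, ih]

theorem norm_gaussSum_mul_inv (hψ : ψ.IsPrimitive) {χ : MulChar F Ω} (hχ : χ ≠ 1) :
    ‖gaussSum χ ψ‖ * ‖gaussSum χ⁻¹ ψ‖ = ‖(Fintype.card F : Ω)‖ := by
  rw [← gaussSum_mul_gaussSum_eq_card hχ hψ, ← mul_gaussSum_inv_eq_gaussSum χ⁻¹ ψ, norm_mul,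
    norm_mul, norm_mulChar _ (neg_ne_zero.2 one_ne_zero), one_mul]

theorem mulChar_apply_eq_one_iff {χ : MulChar F Ω} (hχ : orderOf χ = Fintype.card F - 1) {x : F}
    (hx : x ≠ 0) : χ x = 1 ↔ x = 1 := by
  refine ⟨fun h => ?_, fun h => by rw [h, map_one]⟩
  obtain ⟨γ, hγ⟩ := IsCyclic.exists_generator (α := Fˣ)
  obtain ⟨j, hj⟩ := (mem_powers_iff_mem_zpowers.2 (hγ (Units.mk0 x hx)))
  have hxj : x = (γ : F) ^ j := by
    have := congrArg Units.val hj
    simpa using this.symm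
  have h1 : χ ^ j = 1 := by
    refine MulChar.ext fun u => ?_
    obtain ⟨l, rfl⟩ := mem_powers_iff_mem_zpowers.2 (hγ u)
    rw [MulChar.pow_apply_coe, MulChar.one_apply_coe]
    simp only [Units.val_pow_eq_pow_val]
    rw [hxj, map_pow] at h
    rw [map_pow, ← pow_mul, mul_comm, pow_mul, h, one_pow]
  have h2 := orderOf_dvd_of_pow_eq_one h1
  rw [hχ] at h2
  obtain ⟨l, rfl⟩ := h2
  rw [hxj, pow_mul, FiniteField.pow_card_sub_one_eq_one _ γ.ne_zero, one_pow]

theorem sum_mulChar_pow {χ : MulChar F Ω} (hχ : orderOf χ = Fintype.card F - 1) {x : F}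
    (hx : x ≠ 0) [Decidable (x = 1)] : ∑ i ∈ range (Fintype.card F - 1), (χ x) ^ i =
      if x = 1 then (Fintype.card F : Ω) - 1 else 0 := by
  split_ifs with h
  · rw [h, map_one]
    simp [Nat.cast_sub Fintype.card_pos]
  · have h1 : χ x - 1 ≠ 0 := sub_ne_zero.2 fun h' => h ((mulChar_apply_eq_one_iff hχ hx).1 h')
    apply mul_right_cancel₀ h1
    rw [geom_sum_mul, ← map_pow, FiniteField.pow_card_sub_one_eq_one x hx]
    simp

/-- Fourier inversion on the multiplicative group. -/
theorem sum_mulChar_mul_sum {χ : MulChar F Ω} (hχ : orderOf χ = Fintype.card F - 1) (f : F → Ω)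
    (y : Fˣ) : ∑ i ∈ range (Fintype.card F - 1),
      χ ((y⁻¹ : Fˣ) : F) ^ i * ∑ x, (χ ^ i) x * f x = ((Fintype.card F : Ω) - 1) * f y := by
  classical
  have h : ∀ i, χ ((y⁻¹ : Fˣ) : F) ^ i * ∑ x, (χ ^ i) x * f x =
      ∑ u : Fˣ, χ ((y⁻¹ * u : Fˣ) : F) ^ i * f u := by
    intro i
    have h1 : ∑ x, (χ ^ i) x * f x = ∑ u : Fˣ, (χ ^ i) u * f u := by
      rw [← Finset.sum_subset (Finset.subset_univ (Finset.univ.erase (0 : F)))]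
      · refine (Finset.sum_bij (fun (u : Fˣ) _ => (u : F)) ?_ ?_ ?_ ?_).symm
        · intro u _; simp
        · intro u _ v _ huv; exact Units.ext huv
        · intro x hx; exact ⟨Units.mk0 x (Finset.ne_of_mem_erase hx), Finset.mem_univ _, rfl⟩
        · intro u _; rfl
      · intro x _ hx
        have : x = 0 := by simpa using hx
        rw [this, MulChar.map_zero, zero_mul]
    rw [h1, Finset.mul_sum]
    refine Finset.sum_congr rfl fun u _ => ?_
    rw [MulChar.pow_apply_coe, Units.val_mul, map_mul, mul_pow]
    ring
  simp_rw [h]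
  rw [Finset.sum_comm]
  simp_rw [← Finset.sum_mul, sum_mulChar_pow hχ (Units.ne_zero _), Units.val_eq_one,
    inv_mul_eq_one, ite_mul, zero_mul]
  rw [Finset.sum_ite_eq Finset.univ y]
  simp

variable [IsUltrametricDist Ω]

/-- Jacobi sums are integral, so that the norm of a Gauss sum is supermultiplicative in the
multiplicative character. -/
theorem norm_gaussSum_mul_le {χ φ : MulChar F Ω} (h : χ * φ ≠ 1) :
    ‖gaussSum χ ψ‖ * ‖gaussSum φ ψ‖ ≤ ‖gaussSum (χ * φ) ψ‖ := by
  rw [← norm_mul, ← jacobiSum_mul_nontrivial h ψ, norm_mul]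
  refine mul_le_of_le_one_right (norm_nonneg _) ?_
  refine IsUltrametricDist.norm_sum_le_of_forall_le_of_nonneg zero_le_one fun x _ => ?_
  rw [norm_mul]
  exact mul_le_one₀ (norm_mulChar_le χ x) (norm_nonneg _) (norm_mulChar_le φ _)

/-- One half of Stickelberger's theorem: if `c` is a lower bound for the norm of the Gauss sum of
`χ`, then `c ^ (∑ a_i)` is one for that of `χ ^ (∑ a_i p^i)`. -/
theorem pow_weight_le_norm_gaussSum (p : ℕ) [Fact p.Prime] [CharP F p]
    (hfrob : ∀ x, ψ (x ^ p) = ψ x) {χ : MulChar F Ω} {c : ℝ} (hc0 : 0 ≤ c) (hc1 : c ≤ 1)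
    (hχ : c ≤ ‖gaussSum χ ψ‖) (n : ℕ) (a : ℕ → ℕ) (h : χ ^ digitVal p n a ≠ 1) :
    c ^ weight n a ≤ ‖gaussSum (χ ^ digitVal p n a) ψ‖ := by
  -- adding one power of `p` to the exponent costs one factor `c`
  have step : ∀ m r i : ℕ, (χ ^ m ≠ 1 → c ^ r ≤ ‖gaussSum (χ ^ m) ψ‖) →
      χ ^ (m + p ^ i) ≠ 1 → c ^ (r + 1) ≤ ‖gaussSum (χ ^ (m + p ^ i)) ψ‖ := by
    intro m r i hm hne
    by_cases h1 : χ ^ m = 1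
    · rw [pow_add χ m, h1, one_mul, gaussSum_pow_char_pow p hfrob, pow_succ]
      exact (mul_le_of_le_one_left hc0 (pow_le_one₀ hc0 hc1)).trans hχ
    · rw [pow_add χ m] at hne ⊢
      refine le_trans ?_ (norm_gaussSum_mul_le hne)
      rw [gaussSum_pow_char_pow p hfrob, pow_succ]
      exact mul_le_mul (hm h1) hχ hc0 (norm_nonneg (gaussSum (χ ^ m) ψ))
  have steps : ∀ m r i k : ℕ, (χ ^ m ≠ 1 → c ^ r ≤ ‖gaussSum (χ ^ m) ψ‖) →
      χ ^ (m + k * p ^ i) ≠ 1 → c ^ (r + k) ≤ ‖gaussSum (χ ^ (m + k * p ^ i)) ψ‖ := by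
    intro m r i k hm
    induction k with
    | zero => simpa using hm
    | succ k ih =>
      have := step _ _ i ih
      rwa [add_assoc, ← Nat.succ_mul] at this
  revert h
  induction n with
  | zero => simp [digitVal]
  | succ n ih =>
    rw [digitVal_succ, weight_succ]
    exact steps _ _ _ _ ih

end GaussSums

/-! ### Stickelberger's theorem -/

section Stickelberger

variable {F : Type*} [Field F] [Fintype F] {Ω : Type*} [NormedField Ω] [IsUltrametricDist Ω]
  {ψ : AddChar F Ω} {p n : ℕ} [Fact p.Prime] [CharP F p] {c : ℝ}

theorem exists_norm_gaussSum_ge (hψ : ψ.IsPrimitive) {ω : MulChar F Ω}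
    (hω : orderOf ω = Fintype.card F - 1) (hqc : ‖(Fintype.card F : Ω)‖ < c) {y : Fˣ}
    (hy : ‖ψ y - 1‖ = c) : ∃ χ : MulChar F Ω, χ ≠ 1 ∧ c ≤ ‖gaussSum χ ψ‖ := by
  by_contra! H
  have hc0 : 0 < c := (norm_nonneg _).trans_lt hqc
  have hψ1 : ψ ≠ 1 := by
    rintro rfl
    rw [AddChar.one_apply, sub_self, norm_zero] at hy
    exact hc0.ne hy
  have hpos : 0 < Fintype.card F - 1 := Nat.sub_pos_of_lt Fintype.one_lt_card
  have h := sum_mulChar_mul_sum hω (fun x => ψ x) y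
  rw [← Nat.sub_add_cancel hpos, Finset.sum_range_succ'] at h
  have h0 : ∑ x, (ω ^ 0) x * ψ x = -1 := by
    rw [pow_zero]; exact gaussSum_one_left hψ1
  rw [h0] at h
  have h1 : ψ y - 1 = (Fintype.card F : Ω) * ψ y - ∑ i ∈ range (Fintype.card F - 1 - 1),
      ω ((y⁻¹ : Fˣ) : F) ^ (i + 1) * ∑ x, (ω ^ (i + 1)) x * ψ x := by
    linear_combination h
  have h2 : ‖ψ y - 1‖ < c := by
    rw [h1, sub_eq_add_neg]
    refine (IsUltrametricDist.norm_add_le_max _ _).trans_lt (max_lt ?_ ?_)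
    · rw [norm_mul, norm_addChar, mul_one]; exact hqc
    · rw [norm_neg]
      rcases (range (Fintype.card F - 1 - 1)).eq_empty_or_nonempty with he | hne
      · rw [he, Finset.sum_empty, norm_zero]; exact hc0
      obtain ⟨i, hi, hle⟩ := IsUltrametricDist.exists_norm_finsetSum_le_of_nonempty hne
        (fun i => ω ((y⁻¹ : Fˣ) : F) ^ (i + 1) * ∑ x, (ω ^ (i + 1)) x * ψ x)
      refine hle.trans_lt ?_
      rw [norm_mul, norm_pow, norm_mulChar ω (Units.ne_zero _), one_pow, one_mul]
      refine H (ω ^ (i + 1)) fun h1 => ?_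
      have h3 := Nat.le_of_dvd (Nat.succ_pos i) (orderOf_dvd_of_pow_eq_one h1)
      have h4 := Finset.mem_range.1 hi
      omega
  exact h2.ne hy

/-- A nontrivial character whose Gauss sum has the largest conceivable norm `c` is a generator: if
its order `o` were smaller, then the digits of `o - 1` would give a Gauss sum of `χ⁻¹` that is too
large for the product formula. -/
theorem orderOf_eq_of_norm_gaussSum_ge (hψ : ψ.IsPrimitive) (hfrob : ∀ x, ψ (x ^ p) = ψ x)
    (hcard : Fintype.card F = p ^ n) (hc0 : 0 < c) (hc1 : c < 1)
    (hq : ‖(Fintype.card F : Ω)‖ = c ^ (n * (p - 1))) {χ : MulChar F Ω} (hχ1 : χ ≠ 1)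
    (hχ : c ≤ ‖gaussSum χ ψ‖) : orderOf χ = Fintype.card F - 1 := by
  have hp2 : 2 ≤ p := (Fact.out : p.Prime).two_le
  have hF : 1 < Fintype.card F := Fintype.one_lt_card
  by_contra hne
  obtain ⟨k, hk⟩ := χ.orderOf_dvd_card_sub_one
  have ho : 0 < orderOf χ := χ.orderOf_pos
  have h2 : 2 * orderOf χ ≤ Fintype.card F - 1 := by
    have hk2 : 2 ≤ k := by
      rcases k with _ | _ | k
      · omega
      · omega
      · omega
    rw [hk, mul_comm]
    exact Nat.mul_le_mul_left _ hk2
  obtain ⟨a, ha, hav⟩ := exists_digits (b := p) (n := n) (m := orderOf χ - 1) (by omega) (by omega)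
  have hinv : χ ^ digitVal p n a = χ⁻¹ := by
    rw [hav]
    refine (inv_eq_of_mul_eq_one_right ?_).symm
    rw [← pow_succ', Nat.sub_add_cancel ho, pow_orderOf_eq_one]
  have h3 := pow_weight_le_norm_gaussSum p hfrob hc0.le hc1.le hχ n a
    (by rw [hinv]; exact inv_ne_one.2 hχ1)
  rw [hinv] at h3
  have h4 : c ^ (weight n a + 1) ≤ c ^ (n * (p - 1)) := by
    rw [← hq, ← norm_gaussSum_mul_inv hψ hχ1, pow_succ, mul_comm]
    exact mul_le_mul hχ h3 (by positivity) (norm_nonneg _)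
  have h5 : n * (p - 1) ≤ weight n a + 1 := (pow_le_pow_iff_right_of_lt_one₀ hc0 hc1).1 h4
  have h6 := weight_add_weight_compl n ha
  have h7 := digitVal_add_digitVal_compl (b := p) (by omega) n ha
  have h8 := digitVal_le (b := p) (by omega) n (fun i => p - 1 - a i)
  have h9 : weight n (fun i => p - 1 - a i) * p ^ (n - 1) ≤ 1 * p ^ (n - 1) :=
    Nat.mul_le_mul_right _ (by omega)
  have h10 : 2 * p ^ (n - 1) ≤ p ^ n := by
    rcases n with _ | n
    · simp [hcard] at hF
    · rw [pow_succ, mul_comm]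
      exact Nat.mul_le_mul_left _ hp2
  omega

theorem exists_generator_norm_gaussSum_ge [IsAlgClosed Ω] [CharZero Ω] (hψ : ψ.IsPrimitive)
    (hfrob : ∀ x, ψ (x ^ p) = ψ x) (hcard : Fintype.card F = p ^ n) (hc0 : 0 < c) (hc1 : c < 1)
    (hq : ‖(Fintype.card F : Ω)‖ = c ^ (n * (p - 1))) (h2 : 2 < Fintype.card F) {y : Fˣ}
    (hy : ‖ψ y - 1‖ = c) :
    ∃ χ : MulChar F Ω, orderOf χ = Fintype.card F - 1 ∧ c ≤ ‖gaussSum χ ψ‖ := by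
  have : NeZero (Fintype.card F - 1) := ⟨by omega⟩
  have : NeZero ((Fintype.card F - 1 : ℕ) : Ω) := ⟨by exact_mod_cast this.out⟩
  obtain ⟨ζ, hζ⟩ := HasEnoughRootsOfUnity.exists_primitiveRoot Ω (Fintype.card F - 1)
  obtain ⟨ω, hω⟩ := MulChar.exists_mulChar_orderOf F dvd_rfl hζ
  have hqc : ‖(Fintype.card F : Ω)‖ < c := by
    rw [hq]
    refine (pow_lt_pow_right_of_lt_one₀ hc0 hc1 (m := 1) ?_).trans_eq (pow_one c)
    by_contra! hle
    have hp2 : 2 ≤ p := (Fact.out : p.Prime).two_le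
    have hn : 1 ≤ n := by
      rcases n with _ | n
      · simp [hcard] at h2
      · omega
    have h3 : n ≤ 1 := (Nat.le_mul_of_pos_right n (by omega)).trans hle
    have h4 : p - 1 ≤ 1 := (Nat.le_mul_of_pos_left (p - 1) hn).trans hle
    have h5 : n = 1 := by omega
    rw [hcard, h5, pow_one] at h2
    omega
  obtain ⟨χ, hχ1, hχ⟩ := exists_norm_gaussSum_ge hψ hω hqc hy
  exact ⟨χ, orderOf_eq_of_norm_gaussSum_ge hψ hfrob hcard hc0 hc1 hq hχ1 hχ, hχ⟩

/-- The other half of Stickelberger's theorem, by the product formula and complementary digits. -/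
theorem norm_gaussSum_le_pow_weight (hψ : ψ.IsPrimitive) (hfrob : ∀ x, ψ (x ^ p) = ψ x)
    (hcard : Fintype.card F = p ^ n) (hc0 : 0 < c) (hc1 : c < 1)
    (hq : ‖(Fintype.card F : Ω)‖ = c ^ (n * (p - 1))) {χ : MulChar F Ω}
    (hχ : c ≤ ‖gaussSum χ ψ‖) {a : ℕ → ℕ} (ha : ∀ i, a i ≤ p - 1)
    (h1 : χ ^ digitVal p n a ≠ 1) : ‖gaussSum (χ ^ digitVal p n a) ψ‖ ≤ c ^ weight n a := by
  have hp : 0 < p := (Fact.out : p.Prime).pos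
  have hinv : χ ^ digitVal p n (fun i => p - 1 - a i) = (χ ^ digitVal p n a)⁻¹ := by
    refine (inv_eq_of_mul_eq_one_right ?_).symm
    rw [← pow_add, digitVal_add_digitVal_compl hp n ha, ← hcard]
    exact orderOf_dvd_iff_pow_eq_one.1 χ.orderOf_dvd_card_sub_one
  have h3 := pow_weight_le_norm_gaussSum p hfrob hc0.le hc1.le hχ n (fun i => p - 1 - a i)
    (by rw [hinv]; exact inv_ne_one.2 h1)
  rw [hinv] at h3
  have h4 := norm_gaussSum_mul_inv hψ h1
  rw [hq, ← weight_add_weight_compl n ha, pow_add] at h4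
  have h5 : 0 < c ^ weight n (fun i => p - 1 - a i) := by positivity
  refine le_of_mul_le_mul_right ?_ h5
  rw [← h4]
  exact mul_le_mul_of_nonneg_left h3 (norm_nonneg _)

end Stickelberger

/-! ### Weil sums and Gauss sums -/

section WeilGauss

variable {F : Type*} [Field F] [Fintype F] {Ω : Type*} [NormedField Ω]
  {ψ : AddChar F Ω} {p n d : ℕ} [Fact p.Prime] [CharP F p] {c : ℝ}

omit [Fact p.Prime] [CharP F p] in
theorem sum_mulChar_mul_charSum (hd : 0 < d) (hb : Function.Bijective fun x : F => x ^ d)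
    {χ φ : MulChar F Ω} (h : χ * φ ^ d = 1) (hχ : χ ≠ 1) :
    ∑ a, χ a * charSum ψ d 1 (-a) = gaussSum χ ψ * gaussSum φ ψ := by
  have h1 : ∑ a, χ a * charSum ψ d 1 (-a) = ∑ x, ψ (x ^ d) * gaussSum χ (ψ.mulShift x) := by
    simp only [charSum, gaussSum, Finset.mul_sum]
    rw [Finset.sum_comm]
    refine Finset.sum_congr rfl fun x _ => Finset.sum_congr rfl fun a _ => ?_
    rw [show 1 * x ^ d - -a * x = x ^ d + x * a by ring, AddChar.map_add_eq_mul,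
      AddChar.mulShift_apply]
    ring
  rw [h1, mul_comm, gaussSum, Finset.sum_mul,
    ← Equiv.sum_comp (Equiv.ofBijective _ hb) fun x => φ x * ψ x * gaussSum χ ψ]
  refine Finset.sum_congr rfl fun x _ => ?_
  rw [Equiv.ofBijective_apply]
  rcases eq_or_ne x 0 with rfl | hx
  · rw [AddChar.mulShift_zero, gaussSum_one_right hχ, zero_pow hd.ne', MulChar.map_zero]
    simp
  · have h2 := gaussSum_mulShift_eq χ ψ (Units.mk0 x hx)
    rw [Units.val_mk0] at h2
    have h3 : χ⁻¹ = φ ^ d := inv_eq_of_mul_eq_one_right h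
    rw [h2, h3, MulChar.pow_apply' _ hd.ne', ← map_pow φ]
    ring

variable [IsUltrametricDist Ω]

/-- Every pair of digit vectors with `b ≡ -d a` bounds the norm of some Weil sum from below. -/
theorem exists_norm_charSum_ge (hd : 0 < d) (hb : Function.Bijective fun x : F => x ^ d)
    (hgcd : Nat.gcd d (Fintype.card F - 1) = 1) (hfrob : ∀ x, ψ (x ^ p) = ψ x) (hc0 : 0 < c)
    (hc1 : c < 1) {χ : MulChar F Ω} (hord : orderOf χ = Fintype.card F - 1)
    (hχ : c ≤ ‖gaussSum χ ψ‖) (a b : ℕ → ℕ)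
    (hab : Fintype.card F - 1 ∣ digitVal p n b + d * digitVal p n a)
    (ha : ¬ Fintype.card F - 1 ∣ digitVal p n a) :
    ∃ x : F, c ^ (weight n a + weight n b) ≤ ‖charSum ψ d 1 x‖ := by
  have ha1 : χ ^ digitVal p n a ≠ 1 := fun h => ha (hord ▸ orderOf_dvd_of_pow_eq_one h)
  have hb1 : χ ^ digitVal p n b ≠ 1 := by
    intro h
    have h1 : Fintype.card F - 1 ∣ digitVal p n b := hord ▸ orderOf_dvd_of_pow_eq_one h
    exact ha (Nat.Coprime.dvd_of_dvd_mul_left (Nat.Coprime.symm hgcd)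
      ((Nat.dvd_add_right h1).1 hab))
  have hprod : χ ^ digitVal p n b * (χ ^ digitVal p n a) ^ d = 1 := by
    rw [← pow_mul, ← pow_add, mul_comm _ d]
    exact orderOf_dvd_iff_pow_eq_one.1 (hord ▸ hab)
  have h := sum_mulChar_mul_charSum (ψ := ψ) hd hb hprod hb1
  obtain ⟨x, -, hx⟩ := IsUltrametricDist.exists_norm_finsetSum_le_of_nonempty
    (Finset.univ_nonempty (α := F)) (fun x => (χ ^ digitVal p n b) x * charSum ψ d 1 (-x))
  refine ⟨-x, ?_⟩
  rw [h, norm_mul, norm_mul] at hx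
  calc c ^ (weight n a + weight n b) = c ^ weight n b * c ^ weight n a := by
        rw [pow_add, mul_comm]
    _ ≤ ‖gaussSum (χ ^ digitVal p n b) ψ‖ * ‖gaussSum (χ ^ digitVal p n a) ψ‖ :=
      mul_le_mul (pow_weight_le_norm_gaussSum p hfrob hc0.le hc1.le hχ n b hb1)
        (pow_weight_le_norm_gaussSum p hfrob hc0.le hc1.le hχ n a ha1) (by positivity)
        (norm_nonneg _)
    _ ≤ _ := hx
    _ ≤ _ := mul_le_of_le_one_left (norm_nonneg _) (norm_mulChar_le _ x)

/-- The norm of a Weil sum that is not too small is bounded from above by some pair of digit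
vectors with `b ≡ -d a`. -/
theorem exists_weight_le_of_norm_charSum_ge (hψ : ψ.IsPrimitive) (hd : 0 < d)
    (hb : Function.Bijective fun x : F => x ^ d)
    (hgcd : Nat.gcd d (Fintype.card F - 1) = 1) (hfrob : ∀ x, ψ (x ^ p) = ψ x)
    (hcard : Fintype.card F = p ^ n) (hc0 : 0 < c)
    (hc1 : c < 1) (hq : ‖(Fintype.card F : Ω)‖ = c ^ (n * (p - 1))) {χ : MulChar F Ω}
    (hord : orderOf χ = Fintype.card F - 1)
    (hχ : c ≤ ‖gaussSum χ ψ‖) {E : ℕ} (hE : E < n * (p - 1)) {x : F}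
    (hx : c ^ E ≤ ‖charSum ψ d 1 x‖) :
    ∃ a b : ℕ → ℕ, Fintype.card F - 1 ∣ digitVal p n b + d * digitVal p n a ∧
      ¬ Fintype.card F - 1 ∣ digitVal p n a ∧ weight n a + weight n b ≤ E := by
  have hp : 0 < p := (Fact.out : p.Prime).pos
  have hpos : 0 < Fintype.card F - 1 := Nat.sub_pos_of_lt Fintype.one_lt_card
  have hψ1 : ψ ≠ 1 := by
    have := hψ (one_ne_zero (α := F))
    rwa [AddChar.mulShift_one] at this
  have hW0 : charSum ψ d 1 0 = 0 := by
    rw [← AddChar.sum_eq_zero_of_ne_one hψ1, ← Equiv.sum_comp (Equiv.ofBijective _ hb), charSum]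
    simp
  have hx0 : x ≠ 0 := by
    rintro rfl
    rw [hW0, norm_zero] at hx
    exact (pow_pos hc0 E).not_ge hx
  have hq1 : ‖(Fintype.card F : Ω)‖ < 1 := by
    rw [hq]; exact pow_lt_one₀ hc0.le hc1 (by omega)
  have hq2 : ‖(Fintype.card F : Ω) - 1‖ = 1 := by
    rw [norm_sub_rev]
    have := IsUltrametricDist.norm_add_eq_max_of_norm_ne_norm (x := (1 : Ω))
      (y := -(Fintype.card F : Ω)) (by rw [norm_one, norm_neg]; exact hq1.ne')
    rw [sub_eq_add_neg, this, norm_neg, norm_one, max_eq_left hq1.le]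
  have h := sum_mulChar_mul_sum hord (fun a => charSum ψ d 1 (-a)) (-(Units.mk0 x hx0))
  obtain ⟨i, hi, hle⟩ := IsUltrametricDist.exists_norm_finsetSum_le_of_nonempty
    (Finset.nonempty_range_iff.2 hpos.ne')
    (fun i => χ (((-(Units.mk0 x hx0))⁻¹ : Fˣ) : F) ^ i * ∑ a, (χ ^ i) a * charSum ψ d 1 (-a))
  rw [h, norm_mul, norm_mul, norm_pow, norm_mulChar χ (Units.ne_zero _), one_pow, one_mul, hq2,
    one_mul] at hle
  simp only [Units.val_neg, Units.val_mk0, neg_neg] at hle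
  have hi' := Finset.mem_range.1 hi
  rcases Nat.eq_zero_or_pos i with rfl | hi0
  · exfalso
    have h0 : ∑ a, (χ ^ 0) a * charSum ψ d 1 (-a) = (Fintype.card F : Ω) := by
      rw [← sum_charSum hψ hd, ← Equiv.sum_comp (Equiv.neg F) fun a => charSum ψ d 1 a]
      refine Finset.sum_congr rfl fun a _ => ?_
      rw [Equiv.neg_apply]
      rcases eq_or_ne a 0 with rfl | ha
      · rw [neg_zero, hW0]; simp
      · rw [pow_zero, MulChar.one_apply (isUnit_iff_ne_zero.2 ha), one_mul]
    rw [h0, hq] at hle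
    exact hE.not_ge ((pow_le_pow_iff_right_of_lt_one₀ hc0 hc1).1 (hx.trans hle))
  · have hnz : NeZero (Fintype.card F - 1) := ⟨hpos.ne'⟩
    let m : ℕ := (-(i : ZMod (Fintype.card F - 1)) * (d : ZMod (Fintype.card F - 1))⁻¹).val
    have hm : Fintype.card F - 1 ∣ i + d * m := by
      rw [← ZMod.natCast_eq_zero_iff]
      push_cast
      rw [ZMod.natCast_zmod_val]
      linear_combination -(i : ZMod (Fintype.card F - 1)) * ZMod.coe_mul_inv_eq_one d hgcd
    have hmlt : m < Fintype.card F - 1 := ZMod.val_lt _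
    have hi1 : ¬ Fintype.card F - 1 ∣ i := Nat.not_dvd_of_pos_of_lt hi0 hi'
    have hm1 : ¬ Fintype.card F - 1 ∣ m := fun h' =>
      hi1 ((Nat.dvd_add_left (h'.mul_left d)).1 hm)
    obtain ⟨a, ha, hav⟩ := exists_digits (b := p) (n := n) (m := m) hp (by omega)
    obtain ⟨b, hb', hbv⟩ := exists_digits (b := p) (n := n) (m := i) hp (by omega)
    refine ⟨a, b, by rwa [hav, hbv], by rwa [hav], ?_⟩
    have hχi : χ ^ i ≠ 1 := fun h' => hi1 (hord ▸ orderOf_dvd_of_pow_eq_one h')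
    have hχm : χ ^ m ≠ 1 := fun h' => hm1 (hord ▸ orderOf_dvd_of_pow_eq_one h')
    have hprod : χ ^ i * (χ ^ m) ^ d = 1 := by
      rw [← pow_mul, ← pow_add, mul_comm m d]
      exact orderOf_dvd_iff_pow_eq_one.1 (hord ▸ hm)
    rw [sum_mulChar_mul_charSum hd hb hprod hχi, norm_mul] at hle
    have hga := norm_gaussSum_le_pow_weight hψ hfrob hcard hc0 hc1 hq hχ ha (by rwa [hav])
    have hgb := norm_gaussSum_le_pow_weight hψ hfrob hcard hc0 hc1 hq hχ hb' (by rwa [hbv])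
    rw [hav] at hga
    rw [hbv] at hgb
    refine (pow_le_pow_iff_right_of_lt_one₀ hc0 hc1).1 ((hx.trans hle).trans ?_)
    rw [add_comm, pow_add]
    exact mul_le_mul hgb hga (norm_nonneg _) (by positivity)

end WeilGauss

/-! ### The canonical character with `p`-adic values -/

section PadicChar

variable (p : ℕ) [Fact p.Prime] (F : Type*) [Field F] [Algebra (ZMod p) F]

theorem emb_zetaK_pow : emb p (zetaK p) ^ p = 1 := by
  rw [← map_pow, (isPrimitiveRoot_zetaK p).pow_eq_one, map_one]

/-- The canonical additive character of `F`, transported to an algebraic closure of `ℚ_p`. -/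
noncomputable def padicChar : AddChar F (PadicAlgCl p) :=
  (AddChar.zmodChar p (emb_zetaK_pow p)).compAddMonoidHom
    (Algebra.trace (ZMod p) F).toAddMonoidHom

variable {F}

theorem padicChar_apply (x : F) :
    padicChar p F x = emb p (zetaK p) ^ (Algebra.trace (ZMod p) F x).val :=
  rfl

variable [Fintype F]

theorem emb_weilSum (d : ℕ) (a : F) :
    emb p ⟨weilSum p F d a, weilSum_mem p F d a⟩ = charSum (padicChar p F) d 1 a := by
  have h : (⟨weilSum p F d a, weilSum_mem p F d a⟩ : CycField p) =
      ∑ x : F, zetaK p ^ (Algebra.trace (ZMod p) F (x ^ d - a * x)).val := by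
    apply Subtype.ext
    change weilSum p F d a = _
    rw [weilSum]
    push_cast
    exact Finset.sum_congr rfl fun x _ => psi_eq_zeta_pow p F _
  rw [h, map_sum, charSum]
  refine Finset.sum_congr rfl fun x _ => ?_
  rw [map_pow, padicChar_apply, one_mul]

variable (F) in
theorem exists_norm_padicChar_sub_one : ∃ y : Fˣ, ‖padicChar p F y - 1‖ = piNorm p := by
  obtain ⟨y, hy⟩ := Algebra.trace_surjective (ZMod p) F 1
  have hy0 : y ≠ 0 := by
    rintro rfl
    rw [map_zero] at hy
    exact zero_ne_one hy
  have : Fact (1 < p) := ⟨(Fact.out : p.Prime).one_lt⟩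
  refine ⟨Units.mk0 y hy0, ?_⟩
  rw [Units.val_mk0, padicChar_apply, hy, ZMod.val_one, pow_one, piNorm, map_sub, map_one]

theorem isPrimitive_padicChar : (padicChar p F).IsPrimitive := by
  refine AddChar.IsPrimitive.of_ne_one fun h => ?_
  obtain ⟨y, hy⟩ := exists_norm_padicChar_sub_one p F
  rw [h, AddChar.one_apply, sub_self, norm_zero] at hy
  exact (piNorm_pos p).ne hy

theorem padicChar_frobenius (x : F) : padicChar p F (x ^ p) = padicChar p F x := by
  have h := Algebra.trace_eq_of_algEquiv (FiniteField.frobeniusAlgEquivOfAlgebraic (ZMod p) F) x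
  rw [FiniteField.coe_frobeniusAlgEquivOfAlgebraic, ZMod.card] at h
  rw [padicChar_apply, padicChar_apply]
  congr 2

theorem padicChar_frobenius_pow (k : ℕ) (x : F) :
    padicChar p F (x ^ p ^ k) = padicChar p F x := by
  induction k with
  | zero => rw [pow_zero, pow_one]
  | succ k ih => rw [pow_succ, pow_mul, padicChar_frobenius, ih]

theorem card_eq_pow_finrank : Fintype.card F = p ^ Module.finrank (ZMod p) F := by
  rw [Module.card_eq_pow_finrank (K := ZMod p), ZMod.card]

theorem norm_card : ‖(Fintype.card F : PadicAlgCl p)‖ =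
    piNorm p ^ (Module.finrank (ZMod p) F * (p - 1)) := by
  rw [card_eq_pow_finrank p (F := F), Nat.cast_pow, norm_pow, ← piNorm_pow, ← pow_mul, mul_comm]

theorem V_le_of_norm_ge {d : ℕ} (D E : ℕ) (hD : 0 < D) {a : F}
    (h : piNorm p ^ E ≤ ‖charSum (padicChar p F) d 1 a‖ ^ D) :
    V p F d ≤ (((E : ℚ) / (D * ((p : ℚ) - 1)) : ℚ) : WithTop ℚ) := by
  refine (Finset.inf'_le _ (Finset.mem_univ a)).trans ?_
  apply val_le_of_norm_le p D E hD
  rwa [emb_weilSum]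

/-- In the degenerate case `x^d` and `x` have the same absolute trace up to the Frobenius, so that
the Weil sum at `a = 1` is `q` and all others vanish. -/
theorem V_eq_of_degenerate {d : ℕ} (hd : 0 < d) (h : Degenerate p F d) :
    V p F d = ((Module.finrank (ZMod p) F : ℚ) : WithTop ℚ) := by
  classical
  have hp1 : (p : ℚ) - 1 ≠ 0 := by
    have : (1 : ℚ) < p := by exact_mod_cast (Fact.out : p.Prime).one_lt
    linarith
  obtain ⟨k, hk⟩ := h
  have hpow : ∀ x : F, x ^ d = x ^ p ^ k := by
    intro x
    rcases eq_or_ne x 0 with rfl | hx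
    · rw [zero_pow hd.ne', zero_pow (pow_pos (Fact.out : p.Prime).pos k).ne']
    · have h1 : Units.mk0 x hx ^ d = Units.mk0 x hx ^ p ^ k := by
        rw [pow_eq_pow_iff_modEq]
        refine hk.of_dvd ?_
        rw [← Nat.card_units]
        exact orderOf_dvd_natCard _
      simpa using congrArg Units.val h1
  have hW : ∀ a : F, charSum (padicChar p F) d 1 a =
      if 1 - a = 0 then (Fintype.card F : PadicAlgCl p) else 0 := by
    intro a
    rw [← sum_char_mul (isPrimitive_padicChar p), charSum]
    refine Finset.sum_congr rfl fun x _ => ?_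
    rw [one_mul, hpow, sub_eq_add_neg, AddChar.map_add_eq_mul, padicChar_frobenius_pow,
      ← AddChar.map_add_eq_mul]
    congr 1; ring
  have hval1 : val p ⟨weilSum p F d 1, weilSum_mem p F d 1⟩ =
      ((Module.finrank (ZMod p) F : ℚ) : WithTop ℚ) := by
    rw [val_eq_of_norm_eq p (E := Module.finrank (ZMod p) F * (p - 1))]
    · rw [Nat.cast_mul, Nat.cast_sub (Fact.out : p.Prime).one_le, Nat.cast_one,
        mul_div_cancel_right₀ _ hp1]
    · rw [emb_weilSum, hW, if_pos (sub_self 1), norm_card]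
  refine le_antisymm ((Finset.inf'_le _ (Finset.mem_univ 1)).trans_eq hval1) ?_
  refine Finset.le_inf' _ _ fun a _ => ?_
  rcases eq_or_ne a 1 with rfl | ha
  · exact hval1.ge
  · have h0 : (⟨weilSum p F d a, weilSum_mem p F d a⟩ : CycField p) = 0 := by
      apply (emb p).injective
      rw [emb_weilSum, hW, if_neg (sub_ne_zero.2 ha.symm), map_zero]
    rw [h0, val, if_pos rfl]
    exact le_top

/-- The bound `2n/3` holds for every nondegenerate exponent. -/
theorem V_le_two_thirds {d : ℕ} (hd : 0 < d) (hgcd : Nat.gcd d (Nat.card F - 1) = 1)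
    (h : ¬ Degenerate p F d) :
    V p F d ≤ ((2 / 3 * (Module.finrank (ZMod p) F : ℚ) : ℚ) : WithTop ℚ) := by
  have hp1 : (p : ℚ) - 1 ≠ 0 := by
    have : (1 : ℚ) < p := by exact_mod_cast (Fact.out : p.Prime).one_lt
    linarith
  have hb := pow_bijective_of_coprime hd hgcd
  have hqlt : ‖(Fintype.card F : PadicAlgCl p)‖ < 1 := by
    rw [norm_card]
    refine pow_lt_one₀ (piNorm_pos p).le (piNorm_lt_one p) (mul_ne_zero ?_ ?_)
    · exact Module.finrank_pos.ne'
    · exact Nat.sub_ne_zero_of_lt (Fact.out : p.Prime).one_lt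
  obtain ⟨a, ha⟩ : ∃ a : F, ‖(Fintype.card F : PadicAlgCl p)‖ ^ 2 ≤
      ‖charSum (padicChar p F) d 1 a‖ ^ 3 := by
    by_contra! H
    exact h (degenerate_of_additive p hd (additive_of_norm_charSum_lt (isPrimitive_padicChar p) hd
      hb (by simp) hqlt H))
  rw [norm_card, ← pow_mul] at ha
  refine (V_le_of_norm_ge p 3 _ (by norm_num) ha).trans_eq ?_
  rw [WithTop.coe_inj]
  rw [Nat.cast_mul, Nat.cast_mul, Nat.cast_sub (Fact.out : p.Prime).one_le]
  push_cast
  field_simp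

/-- Digit vectors for a subfield of degree `m` bound the valuations over the extension `F`, by the
periodic extension of the digits. -/
theorem V_le_of_digits {d : ℕ} (hd : 0 < d) (hgcd : Nat.gcd d (Nat.card F - 1) = 1) {m t : ℕ}
    (hn : Module.finrank (ZMod p) F = m * t) {a b : ℕ → ℕ}
    (hab : p ^ m - 1 ∣ digitVal p m b + d * digitVal p m a) (ha : ¬ p ^ m - 1 ∣ digitVal p m a) :
    V p F d ≤ (((t * (weight m a + weight m b) : ℚ) / ((p : ℚ) - 1) : ℚ) : WithTop ℚ) := by
  have : CharP F p := charP_of_injective_algebraMap' (ZMod p) p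
  have hp := (Fact.out : p.Prime)
  have hb := pow_bijective_of_coprime hd hgcd
  rw [Nat.card_eq_fintype_card] at hgcd
  have hcard := card_eq_pow_finrank p (F := F)
  rw [hn] at hcard
  have hmt : 0 < m * t := hn ▸ Module.finrank_pos
  have hm : 0 < m := Nat.pos_of_mul_pos_right hmt
  have hS : (p ^ m - 1) * ∑ l ∈ range t, (p ^ m) ^ l = p ^ (m * t) - 1 := by
    have h := Nat.geomSum_eq (m := p ^ m) (Nat.succ_le_of_lt (Nat.one_lt_pow hm.ne' hp.one_lt)) t
    rw [pow_mul, h, Nat.mul_div_cancel']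
    exact Nat.sub_one_dvd_pow_sub_one _ t
  have hS0 : 0 < ∑ l ∈ range t, (p ^ m) ^ l := by
    have h1 : 1 < p ^ (m * t) := Nat.one_lt_pow hmt.ne' hp.one_lt
    by_contra h
    rw [Nat.eq_zero_of_not_pos h] at hS
    omega
  have h2 : 2 < Fintype.card F := by
    rw [hcard]
    by_contra! hle
    have h3 : p ^ m ≤ p ^ (m * t) :=
      Nat.pow_le_pow_right hp.pos (Nat.le_mul_of_pos_right m (Nat.pos_of_mul_pos_left hmt))
    have h4 : 1 < p ^ m := Nat.one_lt_pow hm.ne' hp.one_lt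
    have h5 : p ^ m - 1 = 1 := by omega
    rw [h5] at ha
    exact ha (one_dvd _)
  obtain ⟨y, hy⟩ := exists_norm_padicChar_sub_one p F
  have hq := norm_card p (F := F)
  rw [hn] at hq
  obtain ⟨χ, hord, hχ⟩ := exists_generator_norm_gaussSum_ge (isPrimitive_padicChar p)
    (padicChar_frobenius p) hcard (piNorm_pos p) (piNorm_lt_one p) hq h2 hy
  obtain ⟨x, hx⟩ := exists_norm_charSum_ge (n := m * t) hd hb hgcd (padicChar_frobenius p)
    (piNorm_pos p) (piNorm_lt_one p) hord hχ (fun i => a (i % m)) (fun i => b (i % m))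
    (by
      rw [hcard, digitVal_periodic, digitVal_periodic, ← hS, ← mul_assoc, ← add_mul]
      exact Nat.mul_dvd_mul_right hab _)
    (by
      rw [hcard, digitVal_periodic, ← hS]
      exact fun h => ha (Nat.dvd_of_mul_dvd_mul_right hS0 h))
  rw [weight_periodic, weight_periodic, ← mul_add] at hx
  refine (V_le_of_norm_ge p 1 _ one_pos (hx.trans_eq (pow_one _).symm)).trans_eq ?_
  rw [WithTop.coe_inj]
  push_cast
  rw [one_mul]

end PadicChar

/-! ### Exponents that are degenerate over the subfield of index two -/

section Niho

theorem exists_eq_of_sum_sq_eq_sq_sum {ι : Type*} [Fintype ι] {r : ι → ℚ} (hr : ∀ i, 0 ≤ r i)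
    {s : ℚ} (hs : s ≠ 0) (h1 : ∑ i, r i = s) (h2 : ∑ i, r i ^ 2 = s ^ 2) : ∃ i, r i = s := by
  have hle : ∀ i, r i ≤ s := fun i => by
    rw [← h1]; exact Finset.single_le_sum (fun j _ => hr j) (Finset.mem_univ i)
  have h3 : ∑ i, r i * (s - r i) = 0 := by
    simp_rw [mul_sub, Finset.sum_sub_distrib, ← Finset.sum_mul, ← sq, h1, h2]
    ring
  have h4 := (Finset.sum_eq_zero_iff_of_nonneg
    fun i _ => mul_nonneg (hr i) (sub_nonneg.2 (hle i))).1 h3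
  by_contra! H
  apply hs
  rw [← h1]
  refine Finset.sum_eq_zero fun i hi => ?_
  exact (mul_eq_zero.1 (h4 i hi)).resolve_right (sub_ne_zero.2 (H i).symm)

variable {F : Type*} [Field F] {Ω : Type*} {d : ℕ}

/-- If `ψ(x^d)` is an additive character in `x`, then already `x ↦ x^d` is additive. -/
theorem additive_of_char_pow_eq [CommRing Ω] {ψ : AddChar F Ω} (hψ : ψ.IsPrimitive)
    (hb : Function.Bijective fun x : F => x ^ d) {a : F} (h : ∀ x, ψ (x ^ d) = ψ (a * x))
    (u v : F) : (u + v) ^ d = u ^ d + v ^ d := by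
  by_contra hne
  have hneg := neg_pow_of_bijective hb
  refine hψ (sub_ne_zero.2 hne) ?_
  ext e
  obtain ⟨c, rfl⟩ := hb.2 e
  rw [AddChar.mulShift_apply, AddChar.one_apply,
    show ((u + v) ^ d - (u ^ d + v ^ d)) * (fun x : F => x ^ d) c =
      (c * (u + v)) ^ d + ((-(c * u)) ^ d + (-(c * v)) ^ d) by
        rw [hneg, hneg, mul_pow, mul_pow, mul_pow]; ring,
    AddChar.map_add_eq_mul, AddChar.map_add_eq_mul, h, h, h, ← AddChar.map_add_eq_mul,
    ← AddChar.map_add_eq_mul, ← AddChar.map_zero_eq_one ψ]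
  congr 1
  ring

variable [Fintype F] {K : Type*} [Field K] [Fintype K] {p i : ℕ} [Fact p.Prime]

/-- For an exponent that acts on a subfield `K` as `p^i`, the Weil sum at `a` is determined by the
number of `x` for which `x^d - (ax)^{p^i}` is orthogonal to `K`. -/
theorem card_sub_one_mul_charSum [Field Ω] {ψ : AddChar F Ω}
    (hfrob : ∀ x, ψ (x ^ p ^ i) = ψ x) [CharP K p] (f : K →+* F)
    (hK : ∀ w : K, w ^ d = w ^ p ^ i) (a : F) [DecidablePred fun x : F =>
      ∀ w : K, ψ (f w * (x ^ d - (a * x) ^ p ^ i)) = 1] :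
    ((Fintype.card K : Ω) - 1) * charSum ψ d 1 a =
      (Fintype.card K : Ω) * #{x : F | ∀ w : K, ψ (f w * (x ^ d - (a * x) ^ p ^ i)) = 1} -
        Fintype.card F := by
  classical
  let t : F → F := fun x => x ^ d - (a * x) ^ p ^ i
  have hu : ∀ u : K, u ≠ 0 → ∑ x, ψ (f (u ^ p ^ i) * t x) = charSum ψ d 1 a := by
    intro u hu0
    have hfu : f u ≠ 0 := (map_ne_zero f).2 hu0
    rw [charSum, ← Equiv.sum_comp (Equiv.mulLeft₀ (f u) hfu) fun x => ψ (1 * x ^ d - a * x)]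
    refine Finset.sum_congr rfl fun x _ => ?_
    rw [Equiv.mulLeft₀_apply, one_mul, sub_eq_add_neg, AddChar.map_add_eq_mul, AddChar.map_neg_eq_inv,
      ← hfrob (a * _), ← AddChar.map_neg_eq_inv, ← AddChar.map_add_eq_mul]
    congr 1
    rw [mul_pow (f u), ← map_pow f u d, hK, map_pow]
    simp only [t]
    ring
  have h1 : ∑ w : K, ∑ x, ψ (f w * t x) =
      Fintype.card F + ((Fintype.card K : Ω) - 1) * charSum ψ d 1 a := by
    rw [← Equiv.sum_comp (iterateFrobeniusEquiv K p i).toEquiv,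
      ← Finset.add_sum_erase Finset.univ _ (Finset.mem_univ (0 : K))]
    congr 1
    · simp
    · change ∑ u ∈ Finset.univ.erase (0 : K), ∑ x, ψ (f (u ^ p ^ i) * t x) = _
      rw [Finset.sum_congr rfl fun u hu' => hu u (Finset.ne_of_mem_erase hu'), Finset.sum_const,
        Finset.card_erase_of_mem (Finset.mem_univ _), Finset.card_univ, nsmul_eq_mul,
        Nat.cast_sub Fintype.card_pos, Nat.cast_one]
  have h2 : ∑ w : K, ∑ x, ψ (f w * t x) =
      (Fintype.card K : Ω) * #{x : F | ∀ w : K, ψ (f w * t x) = 1} := by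
    rw [Finset.sum_comm]
    have h3 : ∀ x, ∑ w : K, ψ (f w * t x) =
        if ∀ w : K, ψ (f w * t x) = 1 then (Fintype.card K : Ω) else 0 := by
      intro x
      let φ : AddChar K Ω := (ψ.mulShift (t x)).compAddMonoidHom f.toAddMonoidHom
      have hφ : ∀ w, φ w = ψ (f w * t x) := fun w => by
        rw [mul_comm]; rfl
      have h4 : φ = 0 ↔ ∀ w : K, ψ (f w * t x) = 1 := by
        rw [AddChar.ext_iff]
        simp_rw [hφ, AddChar.zero_apply]
      simp_rw [← h4, ← hφ]
      exact AddChar.sum_eq_ite φ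
    simp_rw [h3]
    rw [Finset.sum_ite]
    simp [mul_comm]
  linear_combination h2 - h1

/-- For a nonadditive power map of a quadratic extension that is degenerate over the subfield, some
Weil sum equals `-|K|`: otherwise all of them would be nonnegative rational numbers, and the first
two moments would leave only one of them nonzero. -/
theorem exists_norm_charSum_ge_of_quadratic [NormedField Ω] [CharZero Ω] {ψ : AddChar F Ω}
    (hψ : ψ.IsPrimitive) (hd : 0 < d) (hb : Function.Bijective fun x : F => x ^ d)
    (hfrob : ∀ x, ψ (x ^ p ^ i) = ψ x) [CharP K p] (f : K →+* F)
    (hcard : Fintype.card F = Fintype.card K ^ 2) (hK : ∀ w : K, w ^ d = w ^ p ^ i)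
    (hnadd : ¬ ∀ u v : F, (u + v) ^ d = u ^ d + v ^ d) :
    ∃ a : F, ‖(Fintype.card K : Ω)‖ ≤ ‖charSum ψ d 1 a‖ := by
  classical
  by_contra! H
  have hQ1 : (1 : ℚ) < Fintype.card K := by exact_mod_cast Fintype.one_lt_card (α := K)
  set Q : ℕ := Fintype.card K with hQ
  have hQ0 : ((Q : Ω) - 1) ≠ 0 := by
    have : (Q : Ω) ≠ (1 : ℕ) := by
      rw [Ne, Nat.cast_inj]
      exact (Fintype.one_lt_card (α := K)).ne'
    rw [Nat.cast_one] at this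
    exact sub_ne_zero.2 this
  have hQ1' : (Q : ℚ) - 1 ≠ 0 := by linarith
  let S : F → Finset F := fun a => {x : F | ∀ w : K, ψ (f w * (x ^ d - (a * x) ^ p ^ i)) = 1}
  have hS : ∀ a x, x ∈ S a ↔ ∀ w : K, ψ (f w * (x ^ d - (a * x) ^ p ^ i)) = 1 := by
    intro a x; simp [S]
  have hW : ∀ a, ((Q : Ω) - 1) * charSum ψ d 1 a = (Q : Ω) * #(S a) - (Q : Ω) ^ 2 := by
    intro a
    have := card_sub_one_mul_charSum (ψ := ψ) hfrob f hK a
    rw [this, hcard, Nat.cast_pow]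
  let r : F → ℚ := fun a => ((Q : ℚ) * #(S a) - (Q : ℚ) ^ 2) / ((Q : ℚ) - 1)
  have hr : ∀ a, charSum ψ d 1 a = (r a : Ω) := by
    intro a
    simp only [r]
    push_cast
    rw [eq_div_iff hQ0, ← hW, mul_comm]
  have hp0 : p ^ i ≠ 0 := (pow_pos (Fact.out : p.Prime).pos i).ne'
  have h0 : ∀ a, (0 : F) ∈ S a := by
    intro a
    rw [hS]
    intro w
    rw [mul_zero, zero_pow hd.ne', zero_pow hp0, sub_zero, mul_zero, AddChar.map_zero_eq_one]
  -- the sets `S a` are stable under multiplication by elements of `K`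
  have hcardS : ∀ a, Q ≤ #(S a) := by
    intro a
    by_cases hex : ∃ x ∈ S a, x ≠ 0
    · obtain ⟨x, hx, hx0⟩ := hex
      rw [hQ, ← Finset.card_univ]
      refine Finset.card_le_card_of_injOn (fun u : K => f u * x) ?_ ?_
      · intro u _
        rw [Finset.mem_coe, hS]
        intro w
        rw [hS] at hx
        rw [← hx (w * u ^ p ^ i), mul_pow, ← map_pow f u d, hK]
        congr 1
        rw [map_mul, map_pow]
        ring
      · intro u _ v _ huv
        exact f.injective (mul_right_cancel₀ hx0 huv)
    · exfalso
      push Not at hex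
      have hS1 : S a = {0} := Finset.eq_singleton_iff_unique_mem.2 ⟨h0 a, hex⟩
      have h1 := hW a
      rw [hS1, Finset.card_singleton, Nat.cast_one] at h1
      have h2 : charSum ψ d 1 a = -(Q : Ω) := by
        apply mul_left_cancel₀ hQ0
        rw [h1]; ring
      have h3 := H a
      rw [h2, norm_neg] at h3
      exact lt_irrefl _ h3
  have hr0 : ∀ a, 0 ≤ r a := by
    intro a
    refine div_nonneg ?_ (by linarith)
    have : (Q : ℚ) ≤ #(S a) := by exact_mod_cast hcardS a
    nlinarith
  have h1 : ∑ a, r a = (Fintype.card F : ℚ) := by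
    have := sum_charSum hψ hd
    simp_rw [hr] at this
    exact_mod_cast this
  have h2 : ∑ a, r a ^ 2 = (Fintype.card F : ℚ) ^ 2 := by
    have := sum_charSum_sq hψ hb
    simp_rw [hr] at this
    exact_mod_cast this
  obtain ⟨a, ha⟩ := exists_eq_of_sum_sq_eq_sq_sum hr0 (by simp) h1 h2
  have hall : S a = Finset.univ := by
    rw [← Finset.card_eq_iff_eq_univ, hcard]
    simp only [r] at ha
    rw [div_eq_iff hQ1', hcard] at ha
    have hQ0' : (Q : ℚ) ≠ 0 := by positivity
    have h3 : (#(S a) : ℚ) = (Q : ℚ) ^ 2 := by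
      apply mul_left_cancel₀ hQ0'
      push_cast at ha
      linear_combination ha
    exact_mod_cast h3
  refine hnadd (additive_of_char_pow_eq hψ hb (a := a) fun x => ?_)
  have h3 := (hS a x).1 (hall ▸ Finset.mem_univ x) 1
  rw [map_one, one_mul, sub_eq_add_neg, AddChar.map_add_eq_mul, AddChar.map_neg_eq_inv, hfrob] at h3
  exact mul_inv_eq_one₀ (by
    intro h4
    have := norm_addChar ψ (a * x)
    rw [h4, norm_zero] at this
    exact zero_ne_one this) |>.1 h3

end Niho

section

variable (p : ℕ) [Fact p.Prime]

/-- Digit vectors for a quadratic extension, for an exponent degenerate over the subfield only. -/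
theorem exists_digits_of_quadratic {d k : ℕ} (hd : 0 < d) (hk : 0 < k)
    (hgcd : Nat.gcd d (p ^ (2 * k) - 1) = 1) (hdeg : ∃ i, d ≡ p ^ i [MOD p ^ k - 1])
    (hndeg : ¬ ∃ i, d ≡ p ^ i [MOD p ^ (2 * k) - 1]) :
    ∃ a b : ℕ → ℕ, p ^ (2 * k) - 1 ∣ digitVal p (2 * k) b + d * digitVal p (2 * k) a ∧
      ¬ p ^ (2 * k) - 1 ∣ digitVal p (2 * k) a ∧
      weight (2 * k) a + weight (2 * k) b ≤ k * (p - 1) := by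
  have hp := (Fact.out : p.Prime)
  obtain ⟨i, hi⟩ := hdeg
  let K := GaloisField p k
  let L := GaloisField p (2 * k)
  have : Fintype K := Fintype.ofFinite K
  have : Fintype L := Fintype.ofFinite L
  have hL : Module.finrank (ZMod p) L = 2 * k := GaloisField.finrank p (by omega)
  have hKr : Module.finrank (ZMod p) K = k := GaloisField.finrank p (by omega)
  have hcL : Fintype.card L = p ^ (2 * k) := by rw [card_eq_pow_finrank p, hL]
  have hcK : Fintype.card K = p ^ k := by rw [card_eq_pow_finrank p, hKr]
  have hgcd' : Nat.gcd d (Nat.card L - 1) = 1 := by rwa [Nat.card_eq_fintype_card, hcL]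
  have hb := pow_bijective_of_coprime hd hgcd'
  obtain ⟨f⟩ : Nonempty (K →ₐ[ZMod p] L) :=
    FiniteField.nonempty_algHom_of_finrank_dvd (by rw [hKr, hL]; exact Dvd.intro_left 2 rfl)
  have hK : ∀ w : K, w ^ d = w ^ p ^ i := by
    intro w
    rcases eq_or_ne w 0 with rfl | hw
    · rw [zero_pow hd.ne', zero_pow (pow_pos hp.pos i).ne']
    · have h1 : Units.mk0 w hw ^ d = Units.mk0 w hw ^ p ^ i := by
        rw [pow_eq_pow_iff_modEq]
        refine hi.of_dvd ?_
        rw [← hcK, ← Nat.card_eq_fintype_card, ← Nat.card_units]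
        exact orderOf_dvd_natCard _
      simpa using congrArg Units.val h1
  have hnadd : ¬ ∀ u v : L, (u + v) ^ d = u ^ d + v ^ d := by
    intro h
    obtain ⟨j, hj⟩ := degenerate_of_additive p hd h
    rw [Nat.card_eq_fintype_card, hcL] at hj
    exact hndeg ⟨j, hj⟩
  obtain ⟨x, hx⟩ := exists_norm_charSum_ge_of_quadratic (isPrimitive_padicChar p (F := L)) hd hb
    (padicChar_frobenius_pow p i) f.toRingHom (by rw [hcL, hcK, mul_comm, pow_mul]) hK hnadd
  have hnK : ‖(Fintype.card K : PadicAlgCl p)‖ = piNorm p ^ (k * (p - 1)) := by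
    rw [norm_card, hKr]
  rw [hnK] at hx
  have hq := norm_card p (F := L)
  rw [hL] at hq
  have hp2 := hp.two_le
  have h2 : 2 < Fintype.card L := by
    rw [hcL, pow_mul]
    calc 2 < (2 ^ 2) ^ 1 := by norm_num
      _ ≤ (p ^ 2) ^ 1 := by gcongr
      _ ≤ (p ^ 2) ^ k := Nat.pow_le_pow_right (by positivity) hk
  obtain ⟨y, hy⟩ := exists_norm_padicChar_sub_one p L
  obtain ⟨χ, hord, hχ⟩ := exists_generator_norm_gaussSum_ge (isPrimitive_padicChar p)
    (padicChar_frobenius p) hcL (piNorm_pos p) (piNorm_lt_one p) hq h2 hy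
  have hE : k * (p - 1) < 2 * k * (p - 1) := by
    refine Nat.mul_lt_mul_of_pos_right (by omega) (by omega)
  rw [← hcL]
  exact exists_weight_le_of_norm_charSum_ge (isPrimitive_padicChar p) hd hb
    (by rwa [Nat.card_eq_fintype_card] at hgcd') (padicChar_frobenius p) hcL (piNorm_pos p)
    (piNorm_lt_one p) hq hord hχ hE hx

variable {F : Type*} [Field F] [Algebra (ZMod p) F] [Fintype F]

theorem V_le_half_of_finrank_eq_two_pow {d : ℕ} (hd : 0 < d)
    (hgcd : Nat.gcd d (Nat.card F - 1) = 1) (hF : ¬ Degenerate p F d)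
    (hp : Degenerate p (ZMod p) d) {s : ℕ} (hs : Module.finrank (ZMod p) F = 2 ^ s) :
    V p F d ≤ ((1 / 2 * (Module.finrank (ZMod p) F : ℚ) : ℚ) : WithTop ℚ) := by
  have hcard : Nat.card F = p ^ 2 ^ s := by
    rw [Nat.card_eq_fintype_card, card_eq_pow_finrank p, hs]
  have hp1 : (0 : ℚ) < (p : ℚ) - 1 := by
    have : (1 : ℚ) < p := by exact_mod_cast (Fact.out : p.Prime).one_lt
    linarith
  -- the place in the tower of quadratic extensions where `d` ceases to be degenerate
  obtain ⟨j, hjs, hj, hj1⟩ : ∃ j < s, (∃ i, d ≡ p ^ i [MOD p ^ 2 ^ j - 1]) ∧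
      ¬ ∃ i, d ≡ p ^ i [MOD p ^ 2 ^ (j + 1) - 1] := by
    by_contra! H
    have h : ∀ j ≤ s, ∃ i, d ≡ p ^ i [MOD p ^ 2 ^ j - 1] := by
      intro j
      induction j with
      | zero => intro _; simpa [Degenerate] using hp
      | succ j ih => exact fun hj => H j (by omega) (ih (by omega))
    exact hF (by simpa only [Degenerate, hcard] using h s le_rfl)
  obtain ⟨t, rfl⟩ := Nat.exists_eq_add_of_lt hjs
  rw [pow_succ, mul_comm] at hj1
  have hn : Module.finrank (ZMod p) F = 2 * 2 ^ j * 2 ^ t := by rw [hs]; ring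
  have hdvd : p ^ (2 * 2 ^ j) - 1 ∣ Nat.card F - 1 := by
    rw [hcard, ← hs, hn, pow_mul p (2 * 2 ^ j)]
    exact Nat.sub_one_dvd_pow_sub_one _ _
  obtain ⟨a, b, hab, ha, hw⟩ := exists_digits_of_quadratic p hd (k := 2 ^ j) (by positivity)
    (Nat.Coprime.coprime_dvd_right hdvd hgcd) hj hj1
  refine (V_le_of_digits p hd hgcd hn hab ha).trans ?_
  rw [WithTop.coe_le_coe, div_le_iff₀ hp1, hn]
  have hw' : ((weight (2 * 2 ^ j) a : ℚ) + weight (2 * 2 ^ j) b) ≤ 2 ^ j * ((p : ℚ) - 1) := by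
    have h1 : (((weight (2 * 2 ^ j) a + weight (2 * 2 ^ j) b : ℕ)) : ℚ) ≤
        ((2 ^ j * (p - 1) : ℕ) : ℚ) := by exact_mod_cast hw
    rwa [Nat.cast_mul, Nat.cast_sub (Fact.out : p.Prime).one_le, Nat.cast_add, Nat.cast_pow,
      Nat.cast_one, Nat.cast_ofNat] at h1
  push_cast
  have h2 : (0 : ℚ) < 2 ^ t := by positivity
  nlinarith

end

/-! ### Short vectors in the prime field and in its quadratic extension -/

section ShortVectors

/-- For a unit `d` modulo `N` different from `1` and `1 + N/2`, the lattice of the pairs `(j, k)`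
with `k ≡ -dj` modulo `N` has a point with `0 < j` and `0 ≤ k` whose coordinate sum is at most
`⌈N/3⌉`. -/
theorem exists_add_le_third {N d : ℕ} (hN : 4 ≤ N) (h2 : 2 ∣ N) (h3 : N % 3 ≠ 2) (hdN : d < N)
    (hgcd : Nat.gcd d N = 1) (hd1 : d ≠ 1) (hdh : d ≠ 1 + N / 2) :
    ∃ j k : ℕ, 0 < j ∧ j < N ∧ N ∣ k + d * j ∧ 3 * (j + k) ≤ N + 2 := by
  have hd2 : d % 2 = 1 := by
    by_contra h
    have h1 : 2 ∣ Nat.gcd d N := Nat.dvd_gcd (by omega) h2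
    rw [hgcd] at h1
    omega
  have hn3 : ¬ (d % 3 = 0 ∧ N % 3 = 0) := by
    rintro ⟨h1, h4⟩
    have h5 : 3 ∣ Nat.gcd d N := Nat.dvd_gcd (by omega) (by omega)
    rw [hgcd] at h5
    omega
  rcases Nat.lt_or_ge N (2 * d) with hlarge | hsmall
  · -- `e ≡ -d` lies between `0` and `N / 2`
    obtain ⟨e, he⟩ : ∃ e, N = d + e := ⟨N - d, by omega⟩
    have hne : ¬ (e % 3 = 0 ∧ N % 3 = 0) := fun h => hn3 (by omega)
    by_cases h4 : 3 * (1 + e) ≤ N + 2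
    · exact ⟨1, e, one_pos, by omega, ⟨1, by omega⟩, h4⟩
    by_cases h5 : 9 * e + 7 ≤ 4 * N
    · exact ⟨3, 3 * e - N, by omega, by omega, ⟨2, by omega⟩, by omega⟩
    -- now `e` is close to `N / 2`, and odd multiples of `e` are close to `N / 2` as well
    obtain ⟨M, hM⟩ := h2
    obtain ⟨δ, hδ⟩ : ∃ δ, M = e + δ := ⟨M - e, by omega⟩
    have hδ2 : 2 ≤ δ := by omega
    have hNδ : 18 * δ ≤ N + 13 := by omega
    obtain ⟨m, hm⟩ : ∃ m, m = M / δ := ⟨_, rfl⟩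
    have hm1 : m * δ ≤ M := hm ▸ Nat.div_mul_le_self M δ
    have hm2 : M < (m + 1) * δ := by
      rw [hm, mul_comm]; exact Nat.lt_mul_div_succ M (by omega)
    have hm3 : 1 ≤ m := by
      by_contra h
      have : m = 0 := by omega
      rw [this] at hm2
      omega
    obtain ⟨l, hl⟩ : ∃ l, l = (m - 1) / 2 := ⟨_, rfl⟩
    have hj1 : 2 * l + 1 ≤ m := by omega
    have hj2 : m ≤ 2 * l + 2 := by omega
    have hjδ : (2 * l + 1) * δ ≤ M := (Nat.mul_le_mul_right δ hj1).trans hm1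
    have hjδ2 : M < (2 * l + 3) * δ :=
      hm2.trans_le (Nat.mul_le_mul_right δ (by omega))
    obtain ⟨k, hk⟩ : ∃ k, M = (2 * l + 1) * δ + k := ⟨M - (2 * l + 1) * δ, by omega⟩
    refine ⟨2 * l + 1, k, by omega, ?_, ⟨l + 1, ?_⟩, ?_⟩
    · have : 2 * l + 1 ≤ (2 * l + 1) * δ := Nat.le_mul_of_pos_right _ (by omega)
      omega
    · have hdM : d = M + δ := by omega
      rw [hdM, hM]
      calc k + (M + δ) * (2 * l + 1) = ((2 * l + 1) * δ + k) + M * (2 * l + 1) := by ring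
        _ = 2 * M * (l + 1) := by rw [← hk]; ring
    · have hδpos : 0 < δ := by omega
      have key : δ * (N - 4 : ℤ) ≤ δ * (6 * (2 * l + 1) * (δ - 1)) := by
        have e1 : (M : ℤ) + 1 ≤ (2 * l + 3) * δ := by exact_mod_cast hjδ2
        have e2 : (N : ℤ) = 2 * M := by exact_mod_cast hM
        have e3 : 18 * (δ : ℤ) ≤ N + 13 := by exact_mod_cast hNδ
        have e4 : (2 : ℤ) ≤ δ := by exact_mod_cast hδ2
        have e5 : 0 ≤ ((δ : ℤ) - 1) * ((2 * l + 3) * δ - (M + 1)) :=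
          mul_nonneg (by linarith) (by linarith)
        have e6 : 0 ≤ ((δ : ℤ) - 2) * (N + 13 - 18 * δ) :=
          mul_nonneg (by linarith) (by linarith)
        nlinarith
      have key2 := le_of_mul_le_mul_left key (by exact_mod_cast hδpos)
      zify at hk hM ⊢
      nlinarith
  · -- `j = ⌊N / d⌋` works
    obtain ⟨a, ha⟩ : ∃ a, a = N / d := ⟨_, rfl⟩
    obtain ⟨r, hr⟩ : ∃ r, r = N % d := ⟨_, rfl⟩
    have hd3 : 3 ≤ d := by
      rcases Nat.eq_zero_or_pos d with rfl | h
      · simp at hd2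
      · omega
    have hdiv : N = d * a + r := by rw [ha, hr]; exact (Nat.div_add_mod N d).symm
    have hrd : r < d := hr ▸ Nat.mod_lt _ (by omega)
    have ha2 : 2 ≤ a := by
      rw [ha, Nat.le_div_iff_mul_le (by omega)]
      exact hsmall
    refine ⟨a, r, by omega, ?_, ⟨1, by rw [hdiv]; ring⟩, ?_⟩
    · nlinarith
    · rcases eq_or_ne a 2 with h | ha3
      · rw [h] at hdiv ⊢; omega
      · have ha3' : 3 ≤ a := by omega
        rcases eq_or_ne d 3 with h | hd3'
        · subst h; omega
        · rcases eq_or_ne d 5 with h | hd5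
          · subst h; omega
          · have hd7 : 7 ≤ d := by omega
            nlinarith

/-- The exceptional residue `1 + (p - 1) / 2` modulo `p - 1`, where `p = 2h - 1` and `h` is odd. The
coordinates of `u + v p` are found from `u - v`, which is small and determines the number modulo
`p + 1`, and `u + v`, which is chosen between two values according to a parity. -/
theorem exists_digit_pair {h d : ℕ} (hh : 7 ≤ h) (hodd : h % 2 = 1)
    (hd : d ≡ h [MOD 2 * (h - 1)]) (hgcd : Nat.gcd d h = 1) (hdodd : d % 2 = 1) :
    ∃ u v u' v' : ℕ, u ≤ 4 ∧ v ≤ 1 ∧ 0 < u ∧ u + v + (u' + v') = h - 1 ∧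
      4 * h * (h - 1) ∣ u' + v' * (2 * h - 1) + d * (u + v * (2 * h - 1)) := by
  -- two odd numbers `δ` and `δ'` with `δ' ≡ -dδ` modulo `h`
  obtain ⟨δ, δ', hδ, hδ'odd, hle, hge, hmod⟩ : ∃ δ δ' : ℤ, (δ = 1 ∨ δ = 3) ∧ δ' % 2 = 1 ∧
      δ' ≤ h - 3 - δ ∧ -(h - 3 - δ) ≤ δ' ∧ (h : ℤ) ∣ δ' + d * δ := by
    obtain ⟨y, hy1, hy2, hy3⟩ : ∃ y : ℤ, -(h : ℤ) ≤ y ∧ y < h ∧ (2 * h : ℤ) ∣ y + d := by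
      refine ⟨(-(d : ℤ) + h) % (2 * h) - h, ?_, ?_, ?_⟩
      · have := Int.emod_nonneg (-(d : ℤ) + h) (b := 2 * h) (by omega)
        omega
      · have := Int.emod_lt_of_pos (-(d : ℤ) + h) (b := 2 * h) (by omega)
        omega
      · have := Int.emod_add_mul_ediv (-(d : ℤ) + h) (2 * h)
        exact ⟨-((-(d : ℤ) + h) / (2 * h)), by linear_combination this⟩
    have hyodd : y % 2 = 1 := by
      obtain ⟨c, hc⟩ := hy3
      rw [mul_assoc] at hc
      omega
    have hydvd : (h : ℤ) ∣ y + d := (Dvd.intro_left 2 rfl).trans hy3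
    have hyne : y ≠ -h := by
      rintro rfl
      have h1 : (h : ℤ) ∣ d := by
        have := (dvd_neg.2 (dvd_refl (h : ℤ)))
        exact (dvd_add_right this).1 hydvd
      have h2 : h ∣ Nat.gcd d h := Nat.dvd_gcd (by exact_mod_cast h1) dvd_rfl
      rw [hgcd] at h2
      have := Nat.le_of_dvd one_pos h2
      omega
    obtain ⟨c, hc⟩ := hydvd
    rcases lt_or_ge (h - 4 : ℤ) y with h1 | h1
    · have hy : y = h - 2 := by omega
      exact ⟨3, h - 6, Or.inr rfl, by omega, by omega, by omega,
        ⟨3 * c - 2, by rw [hy] at hc; linear_combination 3 * hc⟩⟩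
    rcases lt_or_ge y (-(h - 4) : ℤ) with h2 | h2
    · have hy : y = -(h - 2) := by omega
      exact ⟨3, -(h - 6), Or.inr rfl, by omega, by omega, by omega,
        ⟨3 * c + 2, by rw [hy] at hc; linear_combination 3 * hc⟩⟩
    · exact ⟨1, y, Or.inl rfl, hyodd, by omega, by omega, ⟨c, by linear_combination hc⟩⟩
  obtain ⟨ε, hε⟩ : ∃ ε : ℤ, (d : ℤ) = h + 2 * (h - 1) * ε := by
    have h1 := (Nat.modEq_iff_dvd.1 hd.symm)
    obtain ⟨c, hc⟩ := h1
    refine ⟨c, ?_⟩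
    rw [Nat.cast_mul, Nat.cast_sub (by omega)] at hc
    push_cast at hc
    linear_combination hc
  -- it is enough to check divisibility by `4 (h - 1)` and by `h`
  have hcop : IsCoprime (h : ℤ) (4 * (h - 1)) := by
    obtain ⟨g, hg⟩ : ∃ g : ℤ, (h : ℤ) = 2 * g + 1 := ⟨(h : ℤ) / 2, by omega⟩
    have h2 : IsCoprime (h : ℤ) 2 := ⟨1, -g, by linear_combination hg⟩
    have h4 : IsCoprime (h : ℤ) (2 * 2) := h2.mul_right h2
    exact h4.mul_right ⟨1, -1, by ring⟩
  have main : ∀ u v u' v' : ℤ, u - v = δ → u' - v' = δ' → u + v + (u' + v') = h - 1 →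
      (∃ w, 1 + (u + v) + 2 * (ε * (u + v) + v' + d * v) = 4 * w) →
      (4 * h * (h - 1) : ℤ) ∣ u' + v' * (2 * h - 1) + d * (u + v * (2 * h - 1)) := by
    rintro u v u' v' h1 h2 h3 ⟨w, hw⟩
    have e1 : (h : ℤ) ∣ u' + v' * (2 * h - 1) + d * (u + v * (2 * h - 1)) := by
      have : u' + v' * (2 * h - 1) + d * (u + v * (2 * h - 1)) =
          (δ' + d * δ) + h * (2 * v' + 2 * d * v) := by rw [← h1, ← h2]; ring
      rw [this]
      exact dvd_add hmod (Dvd.intro _ rfl)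
    have e2 : (4 * (h - 1) : ℤ) ∣ u' + v' * (2 * h - 1) + d * (u + v * (2 * h - 1)) := by
      refine ⟨w, ?_⟩
      linear_combination h3 + (u + v) * hε + (h - 1 : ℤ) * hw
    have := hcop.mul_dvd e1 e2
    rwa [mul_left_comm, ← mul_assoc] at this
  obtain ⟨v₀, hv₀⟩ : ∃ v₀ : ℤ, h - 1 - δ - δ' = 2 * v₀ :=
    ⟨(h - 1 - δ - δ') / 2, by rcases hδ with rfl | rfl <;> omega⟩
  obtain ⟨e, he⟩ : ∃ e : ℤ, 1 + δ = 2 * e := by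
    rcases hδ with rfl | rfl
    · exact ⟨1, by norm_num⟩
    · exact ⟨2, by norm_num⟩
  have fin : ∀ u v u' v' : ℤ, 0 < u → u ≤ 4 → 0 ≤ v → v ≤ 1 → 0 ≤ u' → 0 ≤ v' → u - v = δ →
      u' - v' = δ' → u + v + (u' + v') = h - 1 →
      (∃ w, 1 + (u + v) + 2 * (ε * (u + v) + v' + d * v) = 4 * w) →
      ∃ u v u' v' : ℕ, u ≤ 4 ∧ v ≤ 1 ∧ 0 < u ∧ u + v + (u' + v') = h - 1 ∧
        4 * h * (h - 1) ∣ u' + v' * (2 * h - 1) + d * (u + v * (2 * h - 1)) := by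
    intro u v u' v' h1 h2 h3 h4 h5 h6 h7 h8 h9 h10
    have hdiv := main u v u' v' h7 h8 h9 h10
    lift u to ℕ using h1.le
    lift v to ℕ using h3
    lift u' to ℕ using h5
    lift v' to ℕ using h6
    refine ⟨u, v, u', v', by omega, by omega, by omega, by omega, ?_⟩
    zify [show 1 ≤ h by omega, show 1 ≤ 2 * h by omega]
    exact hdiv
  rcases Int.even_or_odd' (e + ε * δ + v₀) with ⟨w, hw | hw⟩
  · refine fin δ 0 (v₀ + δ') v₀ (by omega) (by omega) le_rfl (by omega) (by omega) (by omega)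
      (by ring) (by ring) (by linear_combination -hv₀) ⟨w, ?_⟩
    linear_combination he + 2 * hw
  · obtain ⟨d', hd'⟩ : ∃ d' : ℤ, (d : ℤ) = 2 * d' + 1 := ⟨(d : ℤ) / 2, by omega⟩
    refine fin (δ + 1) 1 (v₀ - 1 + δ') (v₀ - 1) (by omega) (by omega) (by omega) le_rfl (by omega)
      (by omega) (by ring) (by ring) (by linear_combination -hv₀) ⟨w + ε + d' + 1, ?_⟩
    linear_combination he + 2 * hw + 2 * hd'

end ShortVectors

/-! ### Exponents that are nondegenerate over the prime field -/

section PrimeField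

theorem natCast_le_ceil_third {p s : ℕ} (h : 3 * s ≤ p + 1) :
    (s : ℚ) ≤ (⌈((p : ℚ) - 1) / 3⌉ : ℚ) := by
  have h1 : (3 * s : ℚ) ≤ p + 1 := by exact_mod_cast h
  have h2 : (s : ℤ) - 1 < ⌈((p : ℚ) - 1) / 3⌉ := by
    rw [Int.lt_ceil]
    push_cast
    linarith
  have h3 : (s : ℤ) ≤ ⌈((p : ℚ) - 1) / 3⌉ := by omega
  exact_mod_cast h3

variable {p : ℕ} [Fact p.Prime] {F : Type*} [Field F] [Fintype F] [Algebra (ZMod p) F] {d : ℕ}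

variable (p) in
theorem sub_one_dvd_card_sub_one : p - 1 ∣ Nat.card F - 1 := by
  rw [Nat.card_eq_fintype_card, card_eq_pow_finrank p]
  exact Nat.sub_one_dvd_pow_sub_one _ _

omit [Fact p.Prime] in
theorem not_modEq_one_of_not_degenerate (h : ¬ Degenerate p (ZMod p) d) :
    ¬ d ≡ 1 [MOD p - 1] := by
  intro h1
  exact h ⟨0, by rwa [Nat.card_zmod, pow_zero]⟩

theorem five_le_of_not_degenerate (hgcd : Nat.gcd d (Nat.card F - 1) = 1)
    (h : ¬ Degenerate p (ZMod p) d) : 5 ≤ p := by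
  have hp := (Fact.out : p.Prime)
  have h1 := not_modEq_one_of_not_degenerate h
  have hc : Nat.gcd d (p - 1) = 1 :=
    Nat.Coprime.coprime_dvd_right (sub_one_dvd_card_sub_one p (F := F)) hgcd
  by_contra hlt
  have h2 := hp.two_le
  obtain rfl | rfl | rfl : p = 2 ∨ p = 3 ∨ p = 4 := by omega
  · exact h1 (Nat.modEq_one)
  · have h3 : d % 2 = 1 := Nat.odd_iff.1 (Nat.coprime_two_right.1 hc)
    exact h1 h3
  · revert hp; norm_num

theorem V_le_of_pair (hd : 0 < d) (hgcd : Nat.gcd d (Nat.card F - 1) = 1) {j k : ℕ} (hj0 : 0 < j)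
    (hj : j < p - 1) (hjk : p - 1 ∣ k + d * j) :
    V p F d ≤ (((Module.finrank (ZMod p) F * (j + k) : ℚ) / ((p : ℚ) - 1) : ℚ) : WithTop ℚ) := by
  have h := V_le_of_digits p hd hgcd (m := 1) (t := Module.finrank (ZMod p) F) (one_mul _).symm
    (a := fun _ => j) (b := fun _ => k) (by simpa [digitVal] using hjk)
    (by simpa [digitVal] using Nat.not_dvd_of_pos_of_lt hj0 hj)
  simpa [weight] using h

theorem exists_pair_of_not_degenerate (hp5 : 5 ≤ p) (hc : Nat.gcd d (p - 1) = 1)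
    (h : ¬ d ≡ 1 [MOD p - 1]) (hex : ¬ d ≡ 1 + (p - 1) / 2 [MOD p - 1]) :
    ∃ j k : ℕ, 0 < j ∧ j < p - 1 ∧ p - 1 ∣ k + d * j ∧ 3 * (j + k) ≤ p + 1 := by
  have hp := (Fact.out : p.Prime)
  have hodd : p % 2 = 1 := Nat.odd_iff.1 (hp.odd_of_ne_two (by omega))
  have h3 : p % 3 ≠ 0 := fun h0 => by
    have := (Nat.prime_dvd_prime_iff_eq Nat.prime_three hp).1 (Nat.dvd_of_mod_eq_zero h0)
    omega
  obtain ⟨j, k, hj0, hj, hjk, hle⟩ := exists_add_le_third (N := p - 1) (d := d % (p - 1))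
    (by omega) (by omega) (by omega) (Nat.mod_lt _ (by omega))
    (by rw [← Nat.gcd_rec, Nat.gcd_comm]; exact hc)
    (fun h1 => h (by rw [Nat.ModEq, h1, Nat.mod_eq_of_lt (by omega)]))
    (fun h1 => hex (by rw [Nat.ModEq, h1, Nat.mod_eq_of_lt (by omega)]))
  refine ⟨j, k, hj0, hj, ?_, by omega⟩
  refine (Nat.ModEq.dvd_iff ?_ dvd_rfl).1 hjk
  exact Nat.ModEq.add_left _ (Nat.ModEq.mul_right _ (Nat.mod_modEq _ _))

/-- In the exceptional residue class the digits `1` and `(p - 1) / 2 - 1` give the bound `n / 2`. -/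
theorem V_le_half_of_exceptional (hd : 0 < d) (hgcd : Nat.gcd d (Nat.card F - 1) = 1) (hp5 : 5 ≤ p)
    (hp4 : p % 4 = 1) (hex : d ≡ 1 + (p - 1) / 2 [MOD p - 1]) :
    V p F d ≤ ((1 / 2 * (Module.finrank (ZMod p) F : ℚ) : ℚ) : WithTop ℚ) := by
  have hdvd : p - 1 ∣ ((p - 1) / 2 - 1) + d * 1 := by
    refine (Nat.ModEq.dvd_iff (Nat.ModEq.add_left _ (Nat.ModEq.mul_right 1 hex)) dvd_rfl).2 ?_
    exact ⟨1, by omega⟩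
  refine (V_le_of_pair hd hgcd one_pos (by omega) hdvd).trans_eq ?_
  rw [WithTop.coe_inj]
  obtain ⟨m, rfl⟩ : ∃ m, p = 4 * m + 1 := ⟨p / 4, by omega⟩
  have hm : (m : ℚ) ≠ 0 := by
    have : m ≠ 0 := by omega
    exact_mod_cast this
  rw [show (4 * m + 1 - 1) / 2 - 1 = 2 * m - 1 by omega, Nat.cast_sub (by omega)]
  push_cast
  field_simp
  ring

/-- In the exceptional residue class the quadratic extension of the prime field gives a better
bound than the prime field. -/
theorem V_le_quarter_of_exceptional (hd : 0 < d) (hgcd : Nat.gcd d (Nat.card F - 1) = 1)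
    (hp13 : 13 ≤ p) (hp4 : p % 4 = 1) (hex : d ≡ 1 + (p - 1) / 2 [MOD p - 1])
    (heven : Even (Module.finrank (ZMod p) F)) :
    V p F d ≤ ((1 / 4 * (Module.finrank (ZMod p) F : ℚ) : ℚ) : WithTop ℚ) := by
  obtain ⟨t, ht⟩ := heven
  have hn : Module.finrank (ZMod p) F = 2 * t := by omega
  obtain ⟨h, hh⟩ : ∃ h, p = 2 * h - 1 ∧ 7 ≤ h ∧ h % 2 = 1 := ⟨(p + 1) / 2, by omega⟩
  obtain ⟨hph, hh7, hh2⟩ := hh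
  have hpp : p ^ 2 - 1 = 4 * h * (h - 1) := by
    obtain ⟨g, rfl⟩ : ∃ g, h = g + 1 := ⟨h - 1, by omega⟩
    have : p = 2 * g + 1 := by omega
    rw [this, Nat.add_sub_cancel]
    have : (2 * g + 1) ^ 2 = 4 * (g + 1) * g + 1 := by ring
    omega
  have hcop : Nat.gcd d (p ^ 2 - 1) = 1 := by
    refine Nat.Coprime.coprime_dvd_right ?_ hgcd
    rw [Nat.card_eq_fintype_card, card_eq_pow_finrank p, hn, pow_mul]
    exact Nat.sub_one_dvd_pow_sub_one _ _
  have hch : Nat.gcd d h = 1 := by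
    refine Nat.Coprime.coprime_dvd_right ?_ hcop
    rw [hpp]
    exact ⟨4 * (h - 1), by ring⟩
  have hc2 : Nat.gcd d 2 = 1 := by
    refine Nat.Coprime.coprime_dvd_right ?_ hcop
    rw [hpp]
    exact ⟨2 * h * (h - 1), by ring⟩
  have hd2 : d % 2 = 1 := Nat.odd_iff.1 (Nat.coprime_two_right.1 hc2)
  have hdh : d ≡ h [MOD 2 * (h - 1)] := by
    rwa [show p - 1 = 2 * (h - 1) by omega, show 1 + 2 * (h - 1) / 2 = h by omega] at hex
  obtain ⟨u, v, u', v', hu, hv, hu0, hsum, hdvd⟩ := exists_digit_pair hh7 hh2 hdh hch hd2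
  rw [← hpp, ← hph] at hdvd
  have hlt : u + v * p < p ^ 2 - 1 := by
    have h1 : v * p ≤ 1 * p := Nat.mul_le_mul_right p hv
    have h2 : 13 * p ≤ p ^ 2 := by rw [sq]; exact Nat.mul_le_mul_right p hp13
    omega
  have hV := V_le_of_digits p hd hgcd hn (a := fun i => if i = 0 then u else v)
    (b := fun i => if i = 0 then u' else v')
    (by simpa [digitVal, Finset.sum_range_succ] using hdvd)
    (by simpa [digitVal, Finset.sum_range_succ] using
      Nat.not_dvd_of_pos_of_lt (show 0 < u + v * p by omega) hlt)
  refine hV.trans_eq ?_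
  rw [WithTop.coe_inj, hn]
  have hw : weight 2 (fun i => if i = 0 then u else v) +
      weight 2 (fun i => if i = 0 then u' else v') = h - 1 := by
    simpa [weight, Finset.sum_range_succ] using hsum
  have hw' : ((weight 2 (fun i => if i = 0 then u else v) : ℚ) +
      weight 2 (fun i => if i = 0 then u' else v')) = h - 1 := by
    have h1 : ((weight 2 (fun i => if i = 0 then u else v) +
      weight 2 (fun i => if i = 0 then u' else v') : ℕ) : ℚ) = ((h - 1 : ℕ) : ℚ) := by rw [hw]
    rwa [Nat.cast_add, Nat.cast_sub (by omega), Nat.cast_one] at h1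
  have hpq : (p : ℚ) = 2 * h - 1 := by
    rw [hph, Nat.cast_sub (by omega)]; push_cast; ring
  have hh0 : (h : ℚ) - 1 ≠ 0 := by
    have : (7 : ℚ) ≤ h := by exact_mod_cast hh7
    linarith
  rw [hw', hpq, show (2 * h - 1 - 1 : ℚ) = 2 * (h - 1) by ring]
  push_cast
  field_simp
  norm_num

theorem V_le_of_not_degenerate_prime (hd : 0 < d) (hgcd : Nat.gcd d (Nat.card F - 1) = 1)
    (h : ¬ Degenerate p (ZMod p) d) :
    ((p ≡ 1 [MOD 4] ∧ Odd (Module.finrank (ZMod p) F)) →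
        V p F d ≤ ((1 / 2 * (Module.finrank (ZMod p) F : ℚ) : ℚ) : WithTop ℚ)) ∧
      (¬ (p ≡ 1 [MOD 4] ∧ Odd (Module.finrank (ZMod p) F)) →
        V p F d ≤
          ((1 / ((p : ℚ) - 1) * (⌈((p : ℚ) - 1) / 3⌉ : ℚ) * (Module.finrank (ZMod p) F : ℚ) : ℚ) :
            WithTop ℚ)) := by
  have hp := (Fact.out : p.Prime)
  have hp5 := five_le_of_not_degenerate hgcd h
  have hpq : (5 : ℚ) ≤ p := by exact_mod_cast hp5
  have hp1 : (0 : ℚ) < (p : ℚ) - 1 := by linarith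
  have hodd : p % 2 = 1 := Nat.odd_iff.1 (hp.odd_of_ne_two (by omega))
  have hc : Nat.gcd d (p - 1) = 1 :=
    Nat.Coprime.coprime_dvd_right (sub_one_dvd_card_sub_one p (F := F)) hgcd
  have hn0 : (0 : ℚ) ≤ Module.finrank (ZMod p) F := Nat.cast_nonneg _
  by_cases hex : d ≡ 1 + (p - 1) / 2 [MOD p - 1]
  · -- `d` is odd, hence `(p - 1) / 2` is even
    have hp4 : p % 4 = 1 := by
      have hd2 : d % 2 = 1 := Nat.odd_iff.1
        (Nat.coprime_two_right.1 (Nat.Coprime.coprime_dvd_right (by omega) hc))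
      have h2 : d % 2 = (1 + (p - 1) / 2) % 2 := hex.of_dvd (by omega : 2 ∣ p - 1)
      omega
    refine ⟨fun _ => V_le_half_of_exceptional hd hgcd hp5 hp4 hex, fun hno => ?_⟩
    have heven : Even (Module.finrank (ZMod p) F) :=
      Nat.not_odd_iff_even.1 fun ho => hno ⟨hp4, ho⟩
    rcases eq_or_ne p 5 with h5 | h5
    · refine (V_le_half_of_exceptional hd hgcd hp5 hp4 hex).trans ?_
      rw [WithTop.coe_le_coe]
      have h2 := natCast_le_ceil_third (p := p) (s := 2) (by omega)
      refine mul_le_mul_of_nonneg_right ?_ hn0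
      have h5' : (p : ℚ) = 5 := by exact_mod_cast h5
      have h3 : 1 / ((p : ℚ) - 1) = 1 / 4 := by rw [h5']; norm_num
      rw [h3]
      push_cast at h2
      linarith
    · have hp13 : 13 ≤ p := by
        by_contra hlt
        have : p = 9 := by omega
        rw [this] at hp
        revert hp; norm_num
      refine (V_le_quarter_of_exceptional hd hgcd hp13 hp4 hex heven).trans ?_
      rw [WithTop.coe_le_coe]
      refine mul_le_mul_of_nonneg_right ?_ hn0
      have h2 := Int.le_ceil (((p : ℚ) - 1) / 3)
      rw [div_mul_eq_mul_div, one_mul, le_div_iff₀ hp1]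
      linarith
  · obtain ⟨j, k, hj0, hj, hjk, hle⟩ := exists_pair_of_not_degenerate hp5 hc
      (not_modEq_one_of_not_degenerate h) hex
    have hV := V_le_of_pair hd hgcd hj0 hj hjk
    constructor
    · intro _
      refine hV.trans ?_
      rw [WithTop.coe_le_coe, div_le_iff₀ hp1]
      have h1 : (3 * (j + k) : ℚ) ≤ p + 1 := by exact_mod_cast hle
      have h2 : ((j : ℚ) + k) ≤ 1 / 2 * ((p : ℚ) - 1) := by linarith
      calc _ ≤ (Module.finrank (ZMod p) F : ℚ) * (1 / 2 * ((p : ℚ) - 1)) :=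
            mul_le_mul_of_nonneg_left h2 hn0
        _ = _ := by ring
    · intro _
      refine hV.trans ?_
      rw [WithTop.coe_le_coe, div_le_iff₀ hp1]
      have h1 := natCast_le_ceil_third hle
      push_cast at h1
      calc _ ≤ (Module.finrank (ZMod p) F : ℚ) * (⌈((p : ℚ) - 1) / 3⌉ : ℚ) :=
            mul_le_mul_of_nonneg_left h1 hn0
        _ = _ := by field_simp

end PrimeField

end WeilSum

theorem theorem1p1 (p : ℕ) [Fact p.Prime] (F : Type*) [Field F] [Fintype F] [Algebra (ZMod p) F]
    (d : ℕ) (hd : 0 < d) (hgcd : Nat.gcd d (Nat.card F - 1) = 1) :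
    (WeilSum.Degenerate p F d →
      WeilSum.V p F d = ((Module.finrank (ZMod p) F : ℚ) : WithTop ℚ)) ∧
    (¬ WeilSum.Degenerate p F d → WeilSum.Degenerate p (ZMod p) d →
      ((∃ s : ℕ, Module.finrank (ZMod p) F = 2 ^ s) →
        WeilSum.V p F d ≤ ((1 / 2 * (Module.finrank (ZMod p) F : ℚ) : ℚ) : WithTop ℚ)) ∧
      ((¬ ∃ s : ℕ, Module.finrank (ZMod p) F = 2 ^ s) →
        WeilSum.V p F d ≤ ((2 / 3 * (Module.finrank (ZMod p) F : ℚ) : ℚ) : WithTop ℚ))) ∧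
    (¬ WeilSum.Degenerate p (ZMod p) d →
      5 ≤ p ∧
      ((p ≡ 1 [MOD 4] ∧ Odd (Module.finrank (ZMod p) F)) →
        WeilSum.V p F d ≤ ((1 / 2 * (Module.finrank (ZMod p) F : ℚ) : ℚ) : WithTop ℚ)) ∧
      (¬ (p ≡ 1 [MOD 4] ∧ Odd (Module.finrank (ZMod p) F)) →
        WeilSum.V p F d ≤
          ((1 / ((p : ℚ) - 1) * (⌈((p : ℚ) - 1) / 3⌉ : ℚ) * (Module.finrank (ZMod p) F : ℚ) : ℚ) :
            WithTop ℚ))) := by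
  refine ⟨WeilSum.V_eq_of_degenerate p hd, fun hF hp => ⟨?_, fun _ => ?_⟩, fun h => ?_⟩
  · rintro ⟨s, hs⟩
    exact WeilSum.V_le_half_of_finrank_eq_two_pow p hd hgcd hF hp hs
  · exact WeilSum.V_le_two_thirds p hd hgcd hF
  · exact ⟨WeilSum.five_le_of_not_degenerate hgcd h,
      WeilSum.V_le_of_not_degenerate_prime hd hgcd h⟩
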